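/- A \emph{hypergraph} $\mathcal H=(V,E)$ has a finite nonempty vertex set $V$ and a set $E$ of subsets of $V$ (hyperedges) such that every vertex belongs to a hyperedge. A \emph{transversal} of $\mathcal H$ is a set of vertices that intersects every hyperedge. The \emph{dual} $\mathcal H^d$ has vertex set $V$, and its hyperedges are the inclusion-minimal transversals of $\mathcal H$. The hypergraph $\mathcal H^d$ is \emph{conformal} if every set $U\subseteq V$, any two distinct members of which lie in a common hyperedge of $\mathcal H^d$, is contained in a hyperedge of $\mathcal H^d$. The \emph{co-occurrence graph} $G(\mathcal H^d)$ has vertex set $V$, and two distinct vertices are adjacent in it if some hyperedge of $\mathcal H^d$ contains both. The problem \textsc{Dual Conformality} asks, for a given hypergraph $\mathcal H$, whether $\mathcal H^d$ is conformal; here $\mathcal H$ has vertices named $0,\dots,n-1$ and is given by a complete list of its hyperedges, in any order and possibly with repetitions, each written as a $0/1$ characteristic vector of length $n$ followed by a separator. Polynomial time refers to deterministic multi-stack Turing machines. \textbf{Observation (Dual Conformality is in co-NP).} \begin{enumerate} \item \textsc{Dual Conformality} (the set of words that represent a hypergraph whose dual is conformal) belongs to co-NP. \item For every hypergraph $\mathcal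 H$, the dual $\mathcal H^d$ is not conformal if and only if there is a certificate, namely a maximal clique of $G(\mathcal H^d)$ that is not a minimal transversal of $\mathcal H$. \item It can be decided in polynomial time, given a word and a $0/1$ vector, whether the word represents a hypergraph $\mathcal H$ and the vector is the characteristic vector of such a certificate for $\mathcal H$. \item Given $\mathcal H$, the adjacency matrix of $G(\mathcal H^d)$ can be computed in polynomial time. \end{enumerate} -/

import Mathlib

/-! ### Hypergraph notions

Hypergraphs are Mathlib's `Hypergraph α`: a vertex set together with a set of hyperedges, which are
subsets of the vertex set; `H.Adj u v` says that some hyperedge contains both `u` and `v`. -/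

namespace Hypergraph

/-- A transversal: a set of vertices that intersects every hyperedge. -/
def IsTransversal {α : Type*} (H : Hypergraph α) (S : Set α) : Prop :=
  S ⊆ H.vertexSet ∧ ∀ e ∈ H.edgeSet, (S ∩ e).Nonempty

/-- The dual hypergraph: the same vertex set; the hyperedges are the inclusion-minimal
transversals. -/
def dual {α : Type*} (H : Hypergraph α) : Hypergraph α where
  vertexSet := H.vertexSet
  edgeSet := {S | Minimal H.IsTransversal S}
  subset_vertexSet_of_mem_edgeSet' := fun _ hS => hS.prop.1

/-- A hypergraph is conformal if every set `U` of vertices, any two distinct members of which lie in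
a common hyperedge, is contained in a hyperedge. -/
def IsConformal {α : Type*} (H : Hypergraph α) : Prop :=
  ∀ U : Set α, U ⊆ H.vertexSet →
    (∀ u ∈ U, ∀ v ∈ U, u ≠ v → H.Adj u v) →
      ∃ e ∈ H.edgeSet, U ⊆ e

/-- The co-occurrence graph: distinct `u`, `v` are adjacent if some hyperedge contains both.
(It is used for hypergraphs whose vertex set is the whole type `α`.) -/
def coOccurrenceGraph {α : Type*} (H : Hypergraph α) : SimpleGraph α where
  Adj u v := u ≠ v ∧ H.Adj u v
  symm := ⟨fun _ _ h => ⟨h.1.symm, h.2.symm⟩⟩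
  loopless := ⟨fun _ h => h.1 rfl⟩

/-- The hypergraphs considered, with vertices named `0, …, n - 1`: the vertex set is nonempty and
every vertex belongs to a hyperedge. -/
structure IsInstance {n : ℕ} (H : Hypergraph (Fin n)) : Prop where
  pos : 0 < n
  vertexSet_eq : H.vertexSet = Set.univ
  exists_mem_edge : ∀ v : Fin n, ∃ e ∈ H.edgeSet, v ∈ e

end Hypergraph

/-! ### Polynomial time, NP and co-NP

Everything is based on Mathlib's multi-stack Turing machines and their number of steps,
`Turing.TM2ComputableInPolyTime`. -/

namespace Complexity

/-- The property `P` of objects of type `α`, given as words through `enc`, is decidable in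
polynomial time. -/
def PolyTimeDecidable {α Γ : Type} (enc : α → List Γ) (P : α → Prop) : Prop :=
  ∃ f : α → Bool, (∀ a, f a = true ↔ P a) ∧
    Nonempty (Turing.TM2ComputableInPolyTime enc Computability.encodeBool f)

/-- The function `f` on words is computable in polynomial time. -/
def PolyTimeComputable {Γ Δ : Type} (f : List Γ → List Δ) : Prop :=
  Nonempty (Turing.TM2ComputableInPolyTime (id : List Γ → List Γ) (id : List Δ → List Δ) f)

/-- The word, over the disjoint union of the two alphabets, that presents a pair `(x, u)` to a
machine: the letters of `x`, followed by the letters of `u`. -/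
def pairWord {Γ Δ : Type} (p : List Γ × List Δ) : List (Γ ⊕ Δ) :=
  p.1.map Sum.inl ++ p.2.map Sum.inr

/-- The class NP: `x ∈ L` iff some certificate `u` of length polynomial in the length of `x`
satisfies `R x u`, where `R` is decidable in polynomial time. -/
def NP {Γ : Type} (L : Language Γ) : Prop :=
  ∃ (R : List Γ → List Bool → Prop) (p : Polynomial ℕ),
    PolyTimeDecidable pairWord (fun xu : List Γ × List Bool => R xu.1 xu.2) ∧
      ∀ x : List Γ, x ∈ L ↔ ∃ u : List Bool, u.length ≤ p.eval x.length ∧ R x u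

/-- The class co-NP: the languages whose complement is in NP. -/
def CoNP {Γ : Type} (L : Language Γ) : Prop :=
  NP Lᶜ

end Complexity

/-! ### The problem -/

namespace DualConformality

/-- The characteristic vector of a set of vertices. -/
noncomputable def bits {n : ℕ} (S : Set (Fin n)) : List Bool :=
  open scoped Classical in List.ofFn fun v => decide (v ∈ S)

/-- The word over `{0, 1, #}` (the letter `#` is `none`) that lists sets of vertices by their
characteristic vectors, each followed by `#`. -/
noncomputable def setsWord {n : ℕ} (l : List (Set (Fin n))) : List (Option Bool) :=
  l.flatMap fun e => (bits e).map some ++ [none]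

/-- `w` represents `H` by a complete list of its hyperedges. -/
def Encodes {n : ℕ} (w : List (Option Bool)) (H : Hypergraph (Fin n)) : Prop :=
  ∃ l : List (Set (Fin n)), (∀ e, e ∈ l ↔ e ∈ H.edgeSet) ∧ w = setsWord l

/-- The adjacency matrix of a graph, row by row, each row followed by `#`. -/
noncomputable def graphWord {n : ℕ} (G : SimpleGraph (Fin n)) : List (Option Bool) :=
  setsWord ((List.finRange n).map fun u => {v | G.Adj u v})

/-- The decision problem: the words that represent a hypergraph whose dual is conformal. -/
def problem : Language (Option Bool) :=
  {w | ∃ (n : ℕ) (H : Hypergraph (Fin n)), H.IsInstance ∧ Encodes w H ∧ H.dual.IsConformal}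

/-- `C` is a maximal clique of the co-occurrence graph of the dual of `H` that is not a minimal
transversal of `H`. -/
def IsCertificate {n : ℕ} (H : Hypergraph (Fin n)) (C : Set (Fin n)) : Prop :=
  Maximal H.dual.coOccurrenceGraph.IsClique C ∧ ¬ Minimal H.IsTransversal C

/-- The word `w` represents a hypergraph for which `c` is the characteristic vector of a
certificate. -/
def CertificateRel (w : List (Option Bool)) (c : List Bool) : Prop :=
  ∃ (n : ℕ) (H : Hypergraph (Fin n)) (C : Set (Fin n)),
    H.IsInstance ∧ Encodes w H ∧ c = bits C ∧ IsCertificate H C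

end DualConformality

/-! ### Structured stack programs and their translation to multi-stack Turing machines -/

namespace StackProgram

/-! A transversal `T` is minimal iff every `v ∈ T` has a private hyperedge, one that meets `T` only
in `v`. Hence `u` and `v` are adjacent in the co-occurrence graph of the dual iff there are
hyperedges `e` (containing `u`, not `v`) and `f` (containing `v`, not `u`) such that the complement
of `e ∪ f`, together with `u` and `v`, is still a transversal (`coOccurrenceGraph_dual_adj_iff`).
This replaces the search over minimal transversals, possibly exponentially many, by quantifiers over
listed hyperedges and vertices.

Hyperedges of the dual are cliques of this graph, and conformality says that every clique lies in
such a hyperedge. So it fails iff some maximal clique is not a minimal transversal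
(`not_isConformal_dual_iff`). Being a maximal clique and not being a minimal transversal are again
conditions on single vertices and hyperedges (`isCertificate_iff`).

All these conditions are therefore first-order formulas about positions in the input word: a vertex
is a position below the first separator `n`, and a hyperedge is a position `e` with a separator at
`e + n`. That a word lists sets at all is expressed by the periodicity of its separators
(`IsPeriodic.exists_eq_setsWord`). A fixed formula is evaluated by nested loops over positions,
hence in polynomial time (`Fml.does_prog`, `Cmd.does_prog`), and such loop programs are compiled to
multi-stack machines (`Run.iterate_step`, `Cmd.nonempty_tm2ComputableInPolyTime`). For co-NP, words
that represent no hypergraph are accepted with any certificate. -/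

/-- Structured programs that operate on stacks and a finite control state. -/
inductive Prog {K : Type} (Γ : K → Type) (σ : Type) : Type
  | push (k : K) (f : σ → Γ k)
  | pop (k : K) (f : σ → Option (Γ k) → σ)
  | peek (k : K) (f : σ → Option (Γ k) → σ)
  | load (f : σ → σ)
  | seq (p q : Prog Γ σ)
  | ite (c : σ → Bool) (p q : Prog Γ σ)
  | loop (c : σ → Bool) (p : Prog Γ σ)

section

variable {K : Type} {Γ : K → Type} {σ : Type}

/-- The control points of a program. -/
def Lab : Prog Γ σ → Type
  | .push _ _ => Unit
  | .pop _ _ => Unit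
  | .peek _ _ => Unit
  | .load _ => Unit
  | .seq p q => Lab p ⊕ Lab q
  | .ite _ p q => Option (Lab p ⊕ Lab q)
  | .loop _ p => Option (Lab p)

/-- A program has finitely many control points. -/
@[reducible] def labFintype : ∀ p : Prog Γ σ, Fintype (Lab p)
  | .push _ _ => inferInstanceAs (Fintype Unit)
  | .pop _ _ => inferInstanceAs (Fintype Unit)
  | .peek _ _ => inferInstanceAs (Fintype Unit)
  | .load _ => inferInstanceAs (Fintype Unit)
  | .seq p q =>
    letI := labFintype p
    letI := labFintype q
    inferInstanceAs (Fintype (Lab p ⊕ Lab q))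
  | .ite _ p q =>
    letI := labFintype p
    letI := labFintype q
    inferInstanceAs (Fintype (Option (Lab p ⊕ Lab q)))
  | .loop _ p =>
    letI := labFintype p
    inferInstanceAs (Fintype (Option (Lab p)))

/-- The control point at which a program starts. -/
def entry : ∀ p : Prog Γ σ, Lab p
  | .push _ _ => ()
  | .pop _ _ => ()
  | .peek _ _ => ()
  | .load _ => ()
  | .seq p _ => Sum.inl (entry p)
  | .ite _ _ _ => (none : Option _)
  | .loop _ _ => (none : Option _)

/-- The machine statements at the control points of a program, where `emb` names the control points
and `ex` is the label to continue with. -/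
def code {Λ : Type} : ∀ p : Prog Γ σ, (Lab p → Λ) → Λ → Lab p → Turing.TM2.Stmt Γ Λ σ
  | .push k f, _, ex, _ => .push k f (.goto fun _ => ex)
  | .pop k f, _, ex, _ => .pop k f (.goto fun _ => ex)
  | .peek k f, _, ex, _ => .peek k f (.goto fun _ => ex)
  | .load f, _, ex, _ => .load f (.goto fun _ => ex)
  | .seq p q, emb, _, .inl l => code p (fun l => emb (.inl l)) (emb (.inr (entry q))) l
  | .seq _ q, emb, ex, .inr l => code q (fun l => emb (.inr l)) ex l
  | .ite c p q, emb, _, none =>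
    .branch c (.goto fun _ => emb (some (.inl (entry p)))) (.goto fun _ => emb (some (.inr (entry q))))
  | .ite _ p _, emb, ex, some (.inl l) => code p (fun l => emb (some (.inl l))) ex l
  | .ite _ _ q, emb, ex, some (.inr l) => code q (fun l => emb (some (.inr l))) ex l
  | .loop c p, emb, ex, none =>
    .branch c (.goto fun _ => emb (some (entry p))) (.goto fun _ => ex)
  | .loop _ p, emb, _, some l => code p (fun l => emb (some l)) (emb none) l

variable [DecidableEq K]

/-- `Run p v S t v' S'`: started with control state `v` and stacks `S`, the program `p` ends with `v'`
and `S'` after `t` steps. -/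
inductive Run : Prog Γ σ → σ → (∀ k, List (Γ k)) → ℕ → σ → (∀ k, List (Γ k)) → Prop
  | push (k f v S) : Run (.push k f) v S 1 v (Function.update S k (f v :: S k))
  | pop (k f v S) : Run (.pop k f) v S 1 (f v (S k).head?) (Function.update S k (S k).tail)
  | peek (k f v S) : Run (.peek k f) v S 1 (f v (S k).head?) S
  | load (f v S) : Run (.load f) v S 1 (f v) S
  | seq {p q v S t v' S' t' v'' S''} : Run p v S t v' S' → Run q v' S' t' v'' S'' →
      Run (.seq p q) v S (t + t') v'' S''
  | iteTrue {c p q v S t v' S'} : c v = true → Run p v S t v' S' → Run (.ite c p q) v S (1 + t) v' S'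
  | iteFalse {c p q v S t v' S'} :
      c v = false → Run q v S t v' S' → Run (.ite c p q) v S (1 + t) v' S'
  | loopDone {c p v S} : c v = false → Run (.loop c p) v S 1 v S
  | loopStep {c p v S t v' S' t' v'' S''} : c v = true → Run p v S t v' S' →
      Run (.loop c p) v' S' t' v'' S'' → Run (.loop c p) v S (1 + t + t') v'' S''

/-- Every statement produced by `code` ends in a `goto`, so one unit of time in `Run` is one machine
step. Requiring `M` to agree with `code` only along `emb` lets the induction pass to subprograms by
composing embeddings. -/
theorem Run.iterate_step {Λ : Type} {M : Λ → Turing.TM2.Stmt Γ Λ σ} {p : Prog Γ σ} {v : σ}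
    {S : ∀ k, List (Γ k)} {t : ℕ} {v' : σ} {S' : ∀ k, List (Γ k)} (h : Run p v S t v' S') :
    ∀ (emb : Lab p → Λ) (ex : Λ), (∀ l, M (emb l) = code p emb ex l) →
      (flip bind (Turing.TM2.step M))^[t] (some ⟨some (emb (entry p)), v, S⟩) =
        some ⟨some ex, v', S'⟩ := by
  have one : ∀ (l : Λ) (v : σ) (S : ∀ k, List (Γ k)),
      (flip bind (Turing.TM2.step M))^[1] (some ⟨some l, v, S⟩) =
        some (Turing.TM2.stepAux (M l) v S) := fun _ _ _ => rfl
  induction h with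
  | push | pop | peek | load =>
    intro emb ex hM
    rw [one, hM]
    rfl
  | @seq p q v S t v' S' t' v'' S'' _ _ ih₁ ih₂ =>
    intro emb ex hM
    rw [Nat.add_comm, Function.iterate_add_apply]
    erw [ih₁ (fun l => emb (Sum.inl l)) (emb (Sum.inr (entry q))) fun l => hM (Sum.inl l)]
    exact ih₂ (fun l => emb (Sum.inr l)) ex fun l => hM (Sum.inr l)
  | @iteTrue c p q v S t v' S' hc _ ih =>
    intro emb ex hM
    rw [Nat.add_comm, Function.iterate_add_apply, one, hM]
    have := ih (fun l => emb (some (Sum.inl l))) ex fun l => hM (some (Sum.inl l))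
    simpa [entry, code, hc] using this
  | @iteFalse c p q v S t v' S' hc _ ih =>
    intro emb ex hM
    rw [Nat.add_comm, Function.iterate_add_apply, one, hM]
    have := ih (fun l => emb (some (Sum.inr l))) ex fun l => hM (some (Sum.inr l))
    simpa [entry, code, hc] using this
  | loopDone hc =>
    intro emb ex hM
    rw [one, hM]
    simp [entry, code, hc]
  | @loopStep c p v S t v' S' t' v'' S'' hc _ _ ih₁ ih₂ =>
    intro emb ex hM
    -- `Function.iterate_add_apply` carries out the right summand first, so the test of the loop
    -- condition is moved to the end of the sum.
    rw [show 1 + t + t' = t' + (t + 1) by omega, Function.iterate_add_apply,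
      Function.iterate_add_apply, one, hM]
    have h₁ := ih₁ (fun l => emb (some l)) (emb none) fun l => hM (some l)
    have h₂ := ih₂ emb ex hM
    have h₃ : Turing.TM2.stepAux (code (Prog.loop c p) emb ex (entry (Prog.loop c p))) v S =
        ⟨some (emb (some (entry p))), v, S⟩ := by simp [entry, code, hc]
    rw [h₃]
    erw [h₁]
    exact h₂

end

/-! ### A fixed arrangement of stacks -/

/-- Names of stacks: the input, an auxiliary stack for the part of the input already read, the
output, the reversed output, a temporary counter, and a counter for every variable. -/
inductive Stack (V : Type) : Type
  | inp
  | aux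
  | out
  | rev
  | tmp
  | var (x : V)
  deriving DecidableEq, Fintype

/-- The alphabets of the stacks. -/
def Alphabet (V A B : Type) : Stack V → Type
  | .inp => A
  | .aux => A
  | .out => B
  | .rev => B
  | .tmp => Unit
  | .var _ => Unit

/-- The contents of the stacks. -/
def stk {V A B : Type} (I J : List A) (O R : List B) (t : ℕ) (env : V → ℕ) :
    ∀ k, List (Alphabet V A B k)
  | .inp => I
  | .aux => J
  | .out => O
  | .rev => R
  | .tmp => List.replicate t ()
  | .var x => List.replicate (env x) ()

section

variable {V A B : Type} [DecidableEq V] {I J : List A} {O R : List B} {t : ℕ} {env : V → ℕ}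

@[simp] theorem update_stk_inp (I' : List A) :
    Function.update (stk I J O R t env) Stack.inp I' = stk I' J O R t env := by
  funext k; cases k <;> simp [Function.update, stk] <;> rfl

@[simp] theorem update_stk_aux (I' : List A) :
    Function.update (stk I J O R t env) Stack.aux I' = stk I I' O R t env := by
  funext k; cases k <;> simp [Function.update, stk] <;> rfl

@[simp] theorem update_stk_out (I' : List B) :
    Function.update (stk I J O R t env) Stack.out I' = stk I J I' R t env := by
  funext k; cases k <;> simp [Function.update, stk] <;> rfl

@[simp] theorem update_stk_rev (I' : List B) :
    Function.update (stk I J O R t env) Stack.rev I' = stk I J O I' t env := by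
  funext k; cases k <;> simp [Function.update, stk] <;> rfl

theorem update_stk_tmp (n : ℕ) :
    Function.update (stk I J O R t env) Stack.tmp (List.replicate n ()) = stk I J O R n env := by
  funext k; cases k <;> simp [Function.update, stk] <;> rfl

theorem update_stk_var (x : V) (n : ℕ) :
    Function.update (stk I J O R t env) (Stack.var x) (List.replicate n ()) =
      stk I J O R t (Function.update env x n) := by
  funext k
  cases k with
  | var y =>
    by_cases h : y = x
    · subst h; simp [stk]
    · simp [stk, Function.update, h]
  | _ => simp [Function.update, stk] <;> rfl

end

end StackProgram

/-! ### Time-bounded runs and their composition -/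

namespace StackProgram

section

variable {K : Type} {Γ : K → Type} {σ : Type} [DecidableEq K]

/-- `p` leads from `v`, `S` to `v'`, `S'` in at most `T` steps. -/
def Does (p : Prog Γ σ) (v : σ) (S : ∀ k, List (Γ k)) (T : ℕ) (v' : σ) (S' : ∀ k, List (Γ k)) :
    Prop :=
  ∃ t ≤ T, Run p v S t v' S'

variable {p q : Prog Γ σ} {v v' v'' : σ} {S S' S'' : ∀ k, List (Γ k)} {T T' : ℕ} {c : σ → Bool}

theorem Does.mono (h : Does p v S T v' S') (hT : T ≤ T') : Does p v S T' v' S' :=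
  let ⟨t, ht, hr⟩ := h
  ⟨t, ht.trans hT, hr⟩

theorem Does.of_eq (h : Does p v S T v' S') (hT : T ≤ T') (hv : v' = v'') (hS : S' = S'') :
    Does p v S T' v'' S'' := by
  subst hv hS
  exact h.mono hT

theorem Does.push {k : K} {f : σ → Γ k} (hv : v' = v)
    (hS : S' = Function.update S k (f v :: S k)) : Does (.push k f) v S 1 v' S' := by
  subst hv hS
  exact ⟨1, le_rfl, .push ..⟩

theorem Does.pop {k : K} {f : σ → Option (Γ k) → σ} (hv : v' = f v (S k).head?)
    (hS : S' = Function.update S k (S k).tail) : Does (.pop k f) v S 1 v' S' := by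
  subst hv hS
  exact ⟨1, le_rfl, .pop ..⟩

theorem Does.peek {k : K} {f : σ → Option (Γ k) → σ} (hv : v' = f v (S k).head?) :
    Does (.peek k f) v S 1 v' S := by
  subst hv
  exact ⟨1, le_rfl, .peek ..⟩

theorem Does.load {f : σ → σ} (hv : v' = f v) : Does (.load f : Prog Γ σ) v S 1 v' S := by
  subst hv
  exact ⟨1, le_rfl, .load ..⟩

theorem Does.seq (h₁ : Does p v S T v' S') (h₂ : Does q v' S' T' v'' S'') :
    Does (.seq p q) v S (T + T') v'' S'' :=
  let ⟨_, ht, hr⟩ := h₁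
  let ⟨_, ht', hr'⟩ := h₂
  ⟨_, add_le_add ht ht', .seq hr hr'⟩

/-- Both branches share the end state and the bound, so the value of the test need not be known when
the lemma is applied. -/
theorem Does.ite (h₁ : c v = true → Does p v S T v' S') (h₂ : c v = false → Does q v S T v' S') :
    Does (.ite c p q) v S (1 + T) v' S' := by
  cases h : c v with
  | true =>
    obtain ⟨t, ht, hr⟩ := h₁ h
    exact ⟨_, by omega, .iteTrue h hr⟩
  | false =>
    obtain ⟨t, ht, hr⟩ := h₂ h
    exact ⟨_, by omega, .iteFalse h hr⟩

theorem Does.loopDone (h : c v = false) : Does (.loop c p) v S 1 v S :=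
  ⟨1, le_rfl, .loopDone h⟩

theorem Does.loopStep (h : c v = true) (h₁ : Does p v S T v' S')
    (h₂ : Does (.loop c p) v' S' T' v'' S'') : Does (.loop c p) v S (1 + T + T') v'' S'' :=
  let ⟨_, ht, hr⟩ := h₁
  let ⟨_, ht', hr'⟩ := h₂
  ⟨_, by omega, .loopStep h hr hr'⟩

/-- A loop whose body is executed `m` times. -/
theorem Does.loop_count (vs : ℕ → σ) (Ss : ℕ → ∀ k, List (Γ k)) (m T : ℕ)
    (hstep : ∀ i < m, c (vs i) = true ∧ Does p (vs i) (Ss i) T (vs (i + 1)) (Ss (i + 1)))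
    (hend : c (vs m) = false) :
    Does (.loop c p) (vs 0) (Ss 0) (m * (T + 1) + 1) (vs m) (Ss m) := by
  induction m generalizing vs Ss with
  | zero => exact (Does.loopDone hend).mono (by omega)
  | succ m ih =>
    have h₀ := hstep 0 (by omega)
    have := ih (fun i => vs (i + 1)) (fun i => Ss (i + 1)) (fun i hi => hstep (i + 1) (by omega)) hend
    exact (Does.loopStep h₀.1 h₀.2 this).mono (by ring_nf; omega)

end

/-! ### Counters and look-up in the input word -/

/-- Control states: a truth value, a loop flag, and letters that were read. -/
abbrev Ctl (A B : Type) := Bool × Bool × Option A × Option B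

/-- Programs over the fixed arrangement of stacks. -/
abbrev Program (V A B : Type) := Prog (Alphabet V A B) (Ctl A B)

section

variable {V A B : Type}

/-- Pop the stack `k` and record in the loop flag whether it was nonempty. -/
def popFlag (k : Stack V) : Program V A B :=
  .pop k fun v o => (v.1, o.isSome, none, none)

/-- Empty the stack `k`. -/
def clear (k : Stack V) : Program V A B :=
  .seq (popFlag k) (.loop (fun v => v.2.1) (popFlag k))

/-- Move a letter of the input to the auxiliary stack, and a unit from `x` to the temporary
counter. -/
def walkStep [Inhabited A] (x : V) : Program V A B :=
  .seq (.pop .inp fun v o => (v.1, v.2.1, o, none)) <|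
  .seq (.ite (fun v => v.2.2.1.isSome) (.push .aux fun v => (v.2.2.1.getD default : A))
    (.load id)) <|
  .seq (.push .tmp fun _ => ()) (popFlag (.var x))

/-- Move the first `x` letters of the input to the auxiliary stack. -/
def walk [Inhabited A] (x : V) : Program V A B :=
  .seq (popFlag (.var x)) <|
  .seq (.loop (fun v => v.2.1) (walkStep x)) <|
  .seq (popFlag .tmp) <|
  .loop (fun v => v.2.1) <| .seq (.push (.var x) fun _ => ()) (popFlag .tmp)

/-- Move all letters of the auxiliary stack back to the input. -/
def rewind [Inhabited A] : Program V A B :=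
  .seq (.pop .aux fun v o => (v.1, false, o, none)) <|
  .loop (fun v => v.2.2.1.isSome) <|
    .seq (.push .inp fun v => (v.2.2.1.getD default : A))
      (.pop .aux fun v o => (v.1, false, o, none))

/-- Move all letters of the reversed output to the output. -/
def deliver [Inhabited B] : Program V A B :=
  .seq (.pop .rev fun v o => (v.1, false, none, o)) <|
  .loop (fun v => v.2.2.2.isSome) <|
    .seq (.push .out fun v => (v.2.2.2.getD default : B))
      (.pop .rev fun v o => (v.1, false, none, o))

/-- Move forward in the input by the sum of some variables, and test the letter found. -/
def lookFrom [Inhabited A] (p : Option A → Bool) : List V → Program V A B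
  | [] => .peek .inp fun _ o => (p o, false, none, none)
  | x :: xs => .seq (walk x) (lookFrom p xs)

/-- Test the letter of the input whose position is the sum of some variables. -/
def look [Inhabited A] (p : Option A → Bool) (xs : List V) : Program V A B :=
  .seq (lookFrom p xs) rewind

/-- Record in the control state whether two variables are positive. -/
def positive (x y : V) : Program V A B :=
  .seq (.peek (.var x) fun v o => (v.1, o.isSome, none, none))
    (.peek (.var y) fun v o => (o.isSome, v.2.1, none, none))

/-- Compare two variables. -/
def less (x y : V) : Program V A B :=
  .seq (positive x y) <|
  .seq (.loop (fun v => v.2.1 && v.1) <|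
    .seq (popFlag (.var x)) <| .seq (popFlag (.var y)) <| .seq (.push .tmp fun _ => ())
    (positive x y)) <|
  .seq (popFlag .tmp) <|
  .loop (fun v => v.2.1) <|
    .seq (.push (.var x) fun _ => ()) <| .seq (.push (.var y) fun _ => ()) (popFlag .tmp)

/-! ### Correctness and running time of the counter and look-up programs -/

variable [DecidableEq V] {I J : List A} {O R : List B} {t : ℕ} {env : V → ℕ} {v : Ctl A B}

theorem head?_replicate_isSome (n : ℕ) : (List.replicate n ()).head?.isSome = decide (0 < n) := by
  cases n <;> simp [List.replicate_succ]

theorem does_clear (k : Stack V) (S : ∀ k, List (Alphabet V A B k)) :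
    Does (clear k) v S (2 * (S k).length + 2) (v.1, false, none, none)
      (Function.update S k []) := by
  -- The flag speaks of the letter popped last, not of what remains, so the loop performs one more
  -- pop on the empty stack before it stops.
  have loop : ∀ (l : List (Alphabet V A B k)) (S : ∀ k, List (Alphabet V A B k))
      (o : Option (Alphabet V A B k)), S k = l → (o = none → l = []) →
      Does (.loop (fun v => v.2.1) (popFlag k)) (v.1, o.isSome, none, none) S
        (2 * l.length + 3) (v.1, false, none, none) (Function.update S k []) := by
    intro l
    induction l with
    | nil =>
      intro S o hS _
      have hS' : Function.update S k [] = S := by rw [← hS]; simp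
      rw [hS']
      cases o with
      | none => exact (Does.loopDone rfl).mono (by omega)
      | some a =>
        refine (Does.loopStep (T := 1) (T' := 1) rfl (Does.pop rfl rfl) ?_).mono (by omega)
        simp only [hS, List.head?_nil, List.tail_nil, Option.isSome_none, hS']
        exact Does.loopDone rfl
    | cons a l ih =>
      intro S o hS ho
      cases o with
      | none => simp at ho
      | some b =>
        refine (Does.loopStep rfl (Does.pop rfl rfl) (v'' := (v.1, false, none, none))
          (S'' := Function.update S k []) (T' := 2 * l.length + 3) ?_).mono (by simp; omega)
        have := ih (Function.update S k l) (some a) (by simp) (by simp)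
        simpa [hS, popFlag] using this
  cases h : S k with
  | nil =>
    refine (Does.seq (T := 1) (T' := 1) (Does.pop rfl rfl) ?_).mono (by omega)
    simp only [h, List.head?_nil, List.tail_nil, Option.isSome_none]
    exact Does.loopDone rfl
  | cons a l =>
    refine (Does.seq (T := 1) (T' := 2 * l.length + 3) (Does.pop rfl rfl) ?_).mono (by simp; omega)
    have := loop l (Function.update S k l) (some a) (by simp) (by simp)
    simpa [h] using this

omit [DecidableEq V] in
theorem isSome_var (x : V) : (stk I J O R t env (.var x)).head?.isSome = decide (0 < env x) :=
  head?_replicate_isSome _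

/-- Truncated subtraction is exact here: popping an empty counter leaves it empty. The flag records
positivity before the decrement. -/
theorem does_popFlag_var (x : V) {n : ℕ} (hn : env x = n) :
    Does (popFlag (.var x)) v (stk I J O R t env) 1
      (v.1, decide (0 < n), none, none) (stk I J O R t (Function.update env x (n - 1))) := by
  subst hn
  refine Does.pop (by rw [isSome_var]) ?_
  rw [← update_stk_var]
  exact congrArg (Function.update (stk I J O R t env) (Stack.var x)) (List.tail_replicate ..).symm

theorem does_popFlag_tmp :
    Does (popFlag .tmp) v (stk I J O R t env) 1
      (v.1, decide (0 < t), none, none) (stk I J O R (t - 1) env) := by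
  refine Does.pop ?_ ?_
  · exact congrArg (fun b => (v.1, b, none, none)) (head?_replicate_isSome _).symm
  · rw [← update_stk_tmp]
    exact congrArg (Function.update (stk I J O R t env) Stack.tmp) (List.tail_replicate ..).symm

theorem does_push_tmp :
    Does (.push .tmp fun _ => ()) v (stk I J O R t env) 1 v (stk I J O R (t + 1) env) :=
  Does.push rfl (update_stk_tmp (t + 1)).symm

theorem does_push_var (x : V) :
    Does (.push (.var x) fun _ => ()) v (stk I J O R t env) 1 v
      (stk I J O R t (Function.update env x (env x + 1))) :=
  Does.push rfl (update_stk_var x (env x + 1)).symm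

theorem does_pop_inp (f : Ctl A B → Option A → Ctl A B) :
    Does (.pop .inp f) v (stk I J O R t env) 1 (f v I.head?) (stk I.tail J O R t env) :=
  Does.pop rfl (update_stk_inp _).symm

theorem does_pop_aux (f : Ctl A B → Option A → Ctl A B) :
    Does (.pop .aux f) v (stk I J O R t env) 1 (f v J.head?) (stk I J.tail O R t env) :=
  Does.pop rfl (update_stk_aux _).symm

theorem does_pop_rev (f : Ctl A B → Option B → Ctl A B) :
    Does (.pop .rev f) v (stk I J O R t env) 1 (f v R.head?) (stk I J O R.tail t env) :=
  Does.pop rfl (update_stk_rev _).symm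

theorem does_push_inp (f : Ctl A B → A) :
    Does (.push .inp f) v (stk I J O R t env) 1 v (stk (f v :: I) J O R t env) :=
  Does.push rfl (update_stk_inp _).symm

theorem does_push_aux (f : Ctl A B → A) :
    Does (.push .aux f) v (stk I J O R t env) 1 v (stk I (f v :: J) O R t env) :=
  Does.push rfl (update_stk_aux _).symm

theorem does_push_out (f : Ctl A B → B) :
    Does (.push .out f) v (stk I J O R t env) 1 v (stk I J (f v :: O) R t env) :=
  Does.push rfl (update_stk_out _).symm

theorem does_push_rev (f : Ctl A B → B) :
    Does (.push .rev f) v (stk I J O R t env) 1 v (stk I J O (f v :: R) t env) :=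
  Does.push rfl (update_stk_rev _).symm

/-- `take 1` and `drop 1` also cover an exhausted input: no letter moves, but the counters still
change. -/
theorem does_walkStep [Inhabited A] (x : V) :
    Does (walkStep x) v (stk I J O R t env) 5 (v.1, decide (0 < env x), none, none)
      (stk (I.drop 1) ((I.take 1).reverse ++ J) O R (t + 1) (Function.update env x (env x - 1))) := by
  refine (Does.seq (does_pop_inp _) (Does.seq (Does.ite (T := 1) (v' := (v.1, v.2.1, I.head?, none))
    (S' := stk I.tail ((I.take 1).reverse ++ J) O R t env) ?_ ?_)
    (Does.seq does_push_tmp ?_))).mono (T := 1 + ((1 + 1) + (1 + 1))) le_rfl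
  · intro h
    cases I with
    | nil => simp at h
    | cons a I => exact does_push_aux _
  · intro h
    cases I with
    | nil => exact Does.load rfl
    | cons a I => simp at h
  · rw [List.drop_one]
    exact does_popFlag_var (v := (v.1, v.2.1, I.head?, none)) x rfl

theorem does_walk [Inhabited A] (x : V) :
    Does (walk x) v (stk I J O R 0 env) (10 * env x + 4) (v.1, false, none, none)
      (stk (I.drop (env x)) ((I.take (env x)).reverse ++ J) O R 0 env) := by
  have h₁ := does_popFlag_var (v := v) (I := I) (J := J) (O := O) (R := R) (t := 0) (env := env)
      x rfl
  -- One unit is popped before the loop, so after `i` rounds the counter holds `env x - 1 - i` while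
  -- the flag is `i < env x`; the last pop finds an empty stack. The second loop restores `x` from
  -- `tmp` with the same shift.
  have h₂ := Does.loop_count (c := fun v => v.2.1) (p := walkStep x)
    (fun i => ((v.1, decide (i < env x), none, none) : Ctl A B))
    (fun i => stk (I.drop i) ((I.take i).reverse ++ J) O R i
      (Function.update env x (env x - 1 - i))) (env x) 5 (fun i hi => ⟨by simpa using hi, by
        have := does_walkStep (v := (v.1, decide (i < env x), none, none)) (I := I.drop i)
            (J := (I.take i).reverse ++ J) (O := O) (R := R)
            (t := i) (env := Function.update env x (env x - 1 - i)) x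
        simp only [Function.update_self, Function.update_idem] at this
        refine this.of_eq le_rfl (by congr 2; simp; omega) ?_
        rw [← List.append_assoc, ← List.reverse_append, ← List.take_add, List.drop_drop,
          Nat.sub_sub _ i 1]⟩) (by simp)
  have h₃ := Does.loop_count (c := fun v => v.2.1) (p :=
      .seq (.push (.var x) fun _ => ()) (popFlag .tmp))
    (fun i => ((v.1, decide (i < env x), none, none) : Ctl A B))
    (fun i => stk (I.drop (env x)) ((I.take (env x)).reverse ++ J) O R (env x - 1 - i)
      (Function.update env x i)) (env x) 2 (fun i hi => ⟨by simpa using hi, by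
        refine Does.seq (T := 1) (T' := 1) (does_push_var x) ?_
        have := does_popFlag_tmp (v := (v.1, decide (i < env x), none, none)) (I := I.drop (env x))
            (J := (I.take (env x)).reverse ++ J) (O := O) (R := R)
            (t := env x - 1 - i) (env := Function.update env x (i + 1))
        simp only [Function.update_self, Function.update_idem]
        convert this using 2
        · simp; omega
        · rw [Nat.sub_sub _ i 1]⟩) (by simp)
  simp only [List.drop_zero, List.take_zero, List.reverse_nil, List.nil_append, Nat.sub_zero,
    Function.update_eq_self, lt_self_iff_false, decide_false,
    show env x - 1 - env x = 0 by omega] at h₂ h₃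
  have h := h₁.seq (h₂.seq (does_popFlag_tmp.seq h₃))
  exact Does.mono (p := walk x) h (by omega)

theorem does_rewind [Inhabited A] :
    Does rewind v (stk I J O R t env) (3 * J.length + 2) (v.1, false, none, none)
      (stk (J.reverse ++ I) [] O R t env) := by
  refine (Does.seq (does_pop_aux _) (T' := 3 * J.length + 1) ?_).mono (by omega)
  induction J generalizing I with
  | nil => exact (Does.loopDone rfl).mono (by omega)
  | cons a J ih =>
    rw [List.reverse_cons, List.append_assoc]
    exact (Does.loopStep rfl ((does_push_inp _).seq (does_pop_aux _)) (ih (I := a :: I))).mono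
      (by simp; omega)

theorem does_deliver [Inhabited B] :
    Does deliver v (stk I J O R t env) (3 * R.length + 2) (v.1, false, none, none)
      (stk I J (R.reverse ++ O) [] t env) := by
  refine (Does.seq (does_pop_rev _) (T' := 3 * R.length + 1) ?_).mono (by omega)
  induction R generalizing O with
  | nil => exact (Does.loopDone rfl).mono (by omega)
  | cons a R ih =>
    rw [List.reverse_cons, List.append_assoc]
    exact (Does.loopStep rfl ((does_push_out _).seq (does_pop_rev _)) (ih (O := a :: O))).mono
      (by simp; omega)

theorem does_lookFrom [Inhabited A] (p : Option A → Bool) (xs : List V) (L : ℕ)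
    (hL : ∀ x, env x ≤ L) :
    Does (lookFrom p xs) v (stk I J O R 0 env) (xs.length * (10 * L + 4) + 1)
      (p I[(xs.map env).sum]?, false, none, none)
      (stk (I.drop (xs.map env).sum) ((I.take (xs.map env).sum).reverse ++ J) O R 0 env) := by
  induction xs generalizing v I J with
  | nil =>
    have h : p I[0]? = p I.head? := by rw [List.head?_eq_getElem?]
    have : Does (lookFrom p ([] : List V)) v (stk I J O R 0 env) 1 (p I[0]?, false, none, none)
        (stk I J O R 0 env) := Does.peek (by rw [h]; rfl)
    simpa using this
  | cons x xs ih =>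
    have h := (does_walk (v := v) (I := I) (J := J) (O := O) (R := R) (env := env) x).seq
      (ih (v := (v.1, false, none, none)) (I := I.drop (env x)) (J := (I.take (env x)).reverse ++ J))
    refine Does.of_eq (p := lookFrom p (x :: xs)) h ?_ ?_ ?_
    · have := hL x
      simp only [List.length_cons, Nat.add_mul]
      omega
    · simp
    · rw [← List.append_assoc, ← List.reverse_append, ← List.take_add, List.drop_drop,
        List.map_cons, List.sum_cons]

/-- The auxiliary stack holds exactly the reversed prefix that was read, so rewinding restores the
input; the extra summand `10 * L + 4` pays for it. -/
theorem does_look [Inhabited A] (p : Option A → Bool) (xs : List V) (L : ℕ)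
    (hL : ∀ x, env x ≤ L) (hI : I.length ≤ L) :
    Does (look p xs) v (stk I [] O R 0 env) ((xs.length + 1) * (10 * L + 4))
      (p I[(xs.map env).sum]?, false, none, none) (stk I [] O R 0 env) := by
  have h := (does_lookFrom (v := v) (I := I) (J := []) (O := O) (R := R) p xs L hL).seq does_rewind
  refine h.of_eq ?_ rfl ?_
  · simp only [List.append_nil, List.length_reverse, List.length_take, Nat.add_mul]
    omega
  · simp

theorem does_positive (x y : V) :
    Does (positive x y) v (stk I J O R t env) 2 (decide (0 < env y), decide (0 < env x), none, none)
      (stk I J O R t env) :=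
  Does.seq (T := 1) (T' := 1) (Does.peek rfl)
    (Does.peek (by simp only [isSome_var]))

/-- Both counters are decremented together until one is empty, while `tmp` counts the `m = min`
rounds from which they are then restored. The variables must differ, or one counter would be popped
twice per round. -/
theorem does_less {x y : V} (hxy : x ≠ y) (L : ℕ) (hx : env x ≤ L) :
    Does (less x y) v (stk I J O R 0 env) (10 * L + 5) (decide (env x < env y), false, none, none)
      (stk I J O R 0 env) := by
  set m := min (env x) (env y) with hm
  let E : ℕ → V → ℕ := fun i => Function.update (Function.update env x (env x - i)) y (env y - i)
  have hEx : ∀ i, E i x = env x - i := fun i => by simp [E, hxy]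
  have hEy : ∀ i, E i y = env y - i := fun i => by simp [E]
  have hE0 : E 0 = env := by simp [E]
  have hstep : ∀ i < m, Does
      (.seq (popFlag (.var x)) <| .seq (popFlag (.var y)) <| .seq (.push .tmp fun _ => ())
        (positive x y))
      (decide (i < env y), decide (i < env x), none, none) (stk I J O R i (E i)) 5
      (decide (i + 1 < env y), decide (i + 1 < env x), none, none)
      (stk I J O R (i + 1) (E (i + 1))) := by
    intro i hi
    have h₁ := does_popFlag_var (v := (decide (i < env y), decide (i < env x), none, none))
      (I := I) (J := J) (O := O) (R := R) (t := i) (env := E i) x (hEx i)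
    have h₂ := does_popFlag_var (v := (decide (i < env y), decide (0 < env x - i), none, none))
      (I := I) (J := J) (O := O) (R := R) (t := i)
      (env := Function.update (E i) x (env x - i - 1)) y (n := env y - i) (by simp [E, hxy.symm])
    have h₃ := (h₁.seq (h₂.seq (does_push_tmp.seq (does_positive x y))))
    have hE' : Function.update (Function.update (E i) x (env x - i - 1)) y (env y - i - 1) =
        E (i + 1) := by
      funext z
      by_cases hz : z = y
      · subst hz; simp [E, Nat.sub_sub]
      · by_cases hz' : z = x <;> simp [E, Function.update_apply, hz, hz', Nat.sub_sub]
    rw [hE', hEx, hEy] at h₃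
    refine h₃.of_eq le_rfl ?_ rfl
    congr 2 <;> simp
  have hback : ∀ i < m, Does
      (.seq (.push (.var x) fun _ => ()) <| .seq (.push (.var y) fun _ => ()) (popFlag .tmp))
      ((decide (env x < env y), decide (i < m), none, none) : Ctl A B)
      (stk I J O R (m - 1 - i) (E (m - i))) 3
      (decide (env x < env y), decide (i + 1 < m), none, none)
      (stk I J O R (m - 1 - (i + 1)) (E (m - (i + 1)))) := by
    intro i hi
    have hE' : Function.update (Function.update (E (m - i)) x (E (m - i) x + 1)) y
        (Function.update (E (m - i)) x (E (m - i) x + 1) y + 1) = E (m - (i + 1)) := by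
      rw [Function.update_of_ne hxy.symm, hEx, hEy]
      funext z
      by_cases hz : z = y
      · subst hz; simp [E]; omega
      · by_cases hz' : z = x
        · subst hz'; simp [E, hz]; omega
        · simp [E, hz, hz']
    have h := (does_push_var (v := ((decide (env x < env y), decide (i < m), none, none) : Ctl A B))
      (I := I) (J := J) (O := O) (R := R) (t := m - 1 - i) (env := E (m - i)) x).seq
      ((does_push_var y).seq does_popFlag_tmp)
    rw [hE'] at h
    refine h.of_eq le_rfl ?_ ?_
    · congr 2; simp; omega
    · rw [Nat.sub_sub _ i 1]
  have h₁ := Does.loop_count (c := fun v : Ctl A B => v.2.1 && v.1) _ _ m 5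
    (fun i hi => ⟨by simp; omega, hstep i hi⟩) (by simp; omega)
  have h₂ := Does.loop_count (c := fun v : Ctl A B => v.2.1) _ _ m 3
    (fun i hi => ⟨by simpa using hi, hback i hi⟩) (by simp)
  have h₀ := does_positive (v := v) (I := I) (J := J) (O := O) (R := R) (t := 0) (env := env) x y
  have h₃ := does_popFlag_tmp (v := (decide (m < env y), decide (m < env x), none, none))
    (I := I) (J := J) (O := O) (R := R) (t := m) (env := E m)
  -- Since `m` is the minimum, `y` has something left after `m` rounds exactly when `env x < env y`.
  have hlt : decide (m < env y) = decide (env x < env y) := by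
    simp only [decide_eq_decide]; omega
  rw [hE0] at h₁
  simp only [hlt] at h₁ h₃
  simp only [Nat.sub_zero, Nat.sub_self, hE0, lt_self_iff_false, decide_false,
    show m - 1 - m = 0 by omega] at h₂
  exact Does.mono (p := less x y) (h₀.seq (h₁.seq (h₃.seq h₂))) (by omega)

end
end StackProgram

namespace StackProgram

/-! ### First-order formulas about positions in a word -/

/-- First-order formulas about positions in a word over `A`, with variables in `V`. -/
inductive Fml (V A : Type) : Type
  | look (p : Option A → Bool) (xs : List V)
  | less (x y : V)
  | not (φ : Fml V A)
  | and (φ ψ : Fml V A)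
  | ex (x : V) (φ : Fml V A)

/-- Programs that write a word by nested loops over the positions of the input. -/
inductive Cmd (V A B : Type) : Type
  | skip
  | emit (b : B)
  | ite (φ : Fml V A) (c d : Cmd V A B)
  | each (x : V) (c : Cmd V A B)

section

variable {V A B : Type} [DecidableEq V]

/-- The truth of a formula in the word `w`; the variables stand for positions `0, …, |w|`, and
`look p xs` says that the letter at the sum of the positions `xs` satisfies `p`. -/
def Fml.Sat (w : List A) : Fml V A → (V → ℕ) → Prop
  | .look p xs, env => p w[(xs.map env).sum]? = true
  | .less x y, env => env x < env y
  | .not φ, env => ¬ φ.Sat w env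
  | .and φ ψ, env => φ.Sat w env ∧ ψ.Sat w env
  | .ex x φ, env => ∃ i ≤ w.length, φ.Sat w (Function.update env x i)

/-- No quantifier binds a variable that is in use, where the variables in `s` are free for binding,
and comparisons involve two different variables. -/
def Fml.WF : Fml V A → Finset V → Prop
  | .look _ _, _ => True
  | .less x y, _ => x ≠ y
  | .not φ, s => φ.WF s
  | .and φ ψ, s => φ.WF s ∧ ψ.WF s
  | .ex x φ, s => x ∈ s ∧ φ.WF (s.erase x)

open scoped Classical in
/-- The word written by a command. -/
noncomputable def Cmd.output (w : List A) : Cmd V A B → (V → ℕ) → List B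
  | .skip, _ => []
  | .emit b, _ => [b]
  | .ite φ c d, env => if φ.Sat w env then c.output w env else d.output w env
  | .each x c, env =>
    (List.range (w.length + 1)).flatMap fun i => c.output w (Function.update env x i)

/-- No loop or quantifier binds a variable that is in use. -/
def Cmd.WF : Cmd V A B → Finset V → Prop
  | .skip, _ => True
  | .emit _, _ => True
  | .ite φ c d, s => φ.WF s ∧ c.WF s ∧ d.WF s
  | .each x c, s => x ∈ s ∧ c.WF (s.erase x)

variable [Inhabited A]

/-- The program that evaluates a formula. -/
def Fml.prog : Fml V A → Program V A B
  | .look p xs => StackProgram.look p xs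
  | .less x y => StackProgram.less x y
  | .not φ => .seq φ.prog (.load fun v => (!v.1, v.2))
  | .and φ ψ => .seq φ.prog (.ite (fun v => v.1) ψ.prog (.load id))
  | .ex x φ =>
    .seq (.load fun _ => (false, true, none, none)) <|
    .seq (.loop (fun v => v.2.1) <|
      .seq φ.prog <|
      -- A witness ends the search, because `φ.prog` leaves the loop flag false. Otherwise the
      -- search goes on while position `x` carries a letter, so `x` ranges over `0, …, |w|`
      -- inclusive.
      .seq (.ite (fun v => v.1) (.load id) <|
        .seq (StackProgram.look Option.isSome [x]) (.load fun v => (false, v.1, none, none))) <|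
      .push (.var x) fun _ => ()) (clear (.var x))

/-- The program that carries out a command, writing the word in reverse. -/
def Cmd.prog : Cmd V A B → Program V A B
  | .skip => .load fun _ => (false, false, none, none)
  | .emit b => .seq (.push .rev fun _ => b) (.load fun _ => (false, false, none, none))
  | .ite φ c d => .seq φ.prog (.ite (fun v => v.1) c.prog d.prog)
  | .each x c =>
    .seq (.load fun _ => (false, true, none, none)) <|
    .seq (.loop (fun v => v.2.1) <|
      .seq c.prog <|
      .seq (StackProgram.look Option.isSome [x]) <|
      .seq (.load fun v => (false, v.1, none, none)) <|
      .push (.var x) fun _ => ()) (clear (.var x))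

/-! ### Formulas and commands run in polynomial time -/

variable {w : List A} {O R : List B} {env : V → ℕ} {v : Ctl A B}

omit [Inhabited A] in
theorem does_clear_var (x : V) {L : ℕ} (hx : env x ≤ L) :
    Does (clear (.var x)) v (stk w [] O R 0 env) (2 * L + 2) (v.1, false, none, none)
      (stk w [] O R 0 (Function.update env x 0)) := by
  refine (does_clear (.var x) (stk w [] O R 0 env)).of_eq ?_ rfl ?_
  · have : (stk w [] O R 0 env (.var x)).length = env x := List.length_replicate
    omega
  · exact update_stk_var x 0

theorem does_look_end (x : V) {L : ℕ} (hL : ∀ x, env x ≤ L) (hw : w.length ≤ L) :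
    Does (StackProgram.look Option.isSome [x]) v (stk w [] O R 0 env) (20 * L + 8)
      (decide (env x < w.length), false, none, none) (stk w [] O R 0 env) := by
  refine (does_look Option.isSome [x] L hL hw).of_eq ?_ ?_ rfl
  · simp; omega
  · exact Prod.ext (Bool.eq_iff_iff.mpr (by simp)) rfl

theorem update_le {L i : ℕ} (hL : ∀ x, env x ≤ L) (hi : i ≤ L) (x : V) :
    ∀ y, Function.update env x i y ≤ L := by
  intro y
  by_cases h : y = x
  · subst h; simpa
  · simpa [h] using hL y

open scoped Classical in
-- The stacks are restored after every evaluation, so programs can be nested, and a quantifier costs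
-- at most `|w| + 1` runs of its body. The counters in `s` are zero: a quantifier can count up from
-- `0`, and clearing its counter afterwards gives back the old environment.
theorem Fml.does_prog (φ : Fml V A) : ∃ T : Polynomial ℕ, ∀ (w : List A) (env : V → ℕ)
    (s : Finset V) (O R : List B) (v : Ctl A B), φ.WF s → (∀ x, env x ≤ w.length) →
      (∀ x ∈ s, env x = 0) →
        Does φ.prog v (stk w [] O R 0 env) (T.eval w.length)
          (decide (φ.Sat w env), false, none, none) (stk w [] O R 0 env) := by
  induction φ with
  | look p xs =>
    refine ⟨Polynomial.C (xs.length + 1) * (Polynomial.C 10 * Polynomial.X + Polynomial.C 4), ?_⟩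
    intro w env s O R v _ hL _
    refine (does_look p xs w.length hL le_rfl).of_eq (by simp)
      (Prod.ext (Bool.eq_iff_iff.mpr (by rw [decide_eq_true_eq]; rfl)) rfl) rfl
  | less x y =>
    refine ⟨Polynomial.C 10 * Polynomial.X + Polynomial.C 5, ?_⟩
    intro w env s O R v hxy hL _
    exact (does_less hxy w.length (hL x)).of_eq (by simp)
      (Prod.ext (Bool.eq_iff_iff.mpr (by simp only [decide_eq_true_eq]; rfl)) rfl) rfl
  | not φ ih =>
    obtain ⟨T, hT⟩ := ih
    refine ⟨T + Polynomial.C 1, ?_⟩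
    intro w env s O R v hφ hL hs
    refine ((hT w env s O R v hφ hL hs).seq (Does.load rfl)).of_eq (by simp)
      (Prod.ext (Bool.eq_iff_iff.mpr (by
        simp only [Bool.not_eq_true', decide_eq_false_iff_not, decide_eq_true_eq]; rfl)) rfl) rfl
  | and φ ψ ih₁ ih₂ =>
    obtain ⟨T₁, hT₁⟩ := ih₁
    obtain ⟨T₂, hT₂⟩ := ih₂
    refine ⟨T₁ + (Polynomial.C 1 + (T₂ + Polynomial.C 1)), ?_⟩
    intro w env s O R v hφ hL hs
    refine Does.of_eq (p := (Fml.and φ ψ).prog) ((hT₁ w env s O R v hφ.1 hL hs).seq (Does.ite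
      (T := T₂.eval w.length + 1)
      (v' := (decide ((Fml.and φ ψ).Sat w env), false, none, none))
      (S' := stk w [] O R 0 env) ?_ ?_)) (by simp) rfl rfl
    · intro h
      refine (hT₂ w env s O R _ hφ.2 hL hs).of_eq (by omega) ?_ rfl
      have h : φ.Sat w env := by simpa using h
      simp [Fml.Sat, h]
    · intro h
      refine (Does.load ?_).mono (by omega)
      have h : ¬ φ.Sat w env := by simpa using h
      simp [Fml.Sat, h]
  | ex x φ ih =>
    obtain ⟨T, hT⟩ := ih
    refine ⟨Polynomial.C 1 + ((Polynomial.X + Polynomial.C 1) *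
      (T + (Polynomial.C 20 * Polynomial.X + Polynomial.C 20)) + Polynomial.C 1 +
        (Polynomial.C 2 * Polynomial.X + Polynomial.C 4)), ?_⟩
    intro w env s O R v hφ hL hs
    set body : Program V A B :=
      .seq φ.prog <|
        .seq (.ite (fun v => v.1) (.load id) <|
          .seq (StackProgram.look Option.isSome [x]) (.load fun v => (false, v.1, none, none))) <|
        .push (.var x) fun _ => () with hbody
    have step : ∀ i ≤ w.length, Does body (false, true, none, none)
        (stk w [] O R 0 (Function.update env x i)) (T.eval w.length + (20 * w.length + 11))
        (decide (φ.Sat w (Function.update env x i)),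
          decide (¬ φ.Sat w (Function.update env x i) ∧ i < w.length), none, none)
        (stk w [] O R 0 (Function.update env x (i + 1))) := by
      intro i hi
      have hL' := update_le hL hi x
      have h₁ := hT w (Function.update env x i) (s.erase x) O R (false, true, none, none) hφ.2 hL'
        fun y hy => by
          rw [Function.update_of_ne (Finset.ne_of_mem_erase hy)]
          exact hs y (Finset.mem_of_mem_erase hy)
      refine Does.of_eq (h₁.seq ((Does.ite (T := 20 * w.length + 9)
        (v' := (decide (φ.Sat w (Function.update env x i)),
          decide (¬ φ.Sat w (Function.update env x i) ∧ i < w.length), none, none))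
        (S' := stk w [] O R 0 (Function.update env x i)) ?_ ?_).seq (does_push_var x)))
        (by omega) rfl (by simp)
      · intro h
        have h : φ.Sat w (Function.update env x i) := by simpa using h
        refine (Does.load ?_).mono (by omega)
        simp [h]
      · intro h
        have h : ¬ φ.Sat w (Function.update env x i) := by simpa using h
        refine ((does_look_end x hL' le_rfl).seq (Does.load rfl)).of_eq (by omega) ?_ rfl
        simp [h]
    -- `d` is the number of positions after `i`. The final counter `k` depends on where a witness
    -- stops the search; only its bound matters, since it is cleared next.
    have key : ∀ d i, i + d = w.length → ∃ k ≤ w.length + 1,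
        Does (.loop (fun v => v.2.1) body)
          (false, true, none, none) (stk w [] O R 0 (Function.update env x i))
          ((d + 1) * (T.eval w.length + (20 * w.length + 20)) + 1)
          (decide (∃ j, i ≤ j ∧ j ≤ w.length ∧ φ.Sat w (Function.update env x j)), false, none, none)
          (stk w [] O R 0 (Function.update env x k)) := by
      intro d
      induction d with
      | zero =>
        intro i hi
        refine ⟨i + 1, by omega, (Does.loopStep rfl (step i (by omega))
          (Does.loopDone (by simp; omega))).of_eq (by omega) ?_ rfl⟩
        refine Prod.ext (Bool.eq_iff_iff.mpr ?_) (Prod.ext (by simp; omega) rfl)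
        simp only [decide_eq_true_eq]
        exact ⟨fun h => ⟨i, le_rfl, by omega, h⟩, fun ⟨j, h₁, h₂, h⟩ =>
          (show j = i by omega) ▸ h⟩
      | succ d ih =>
        intro i hi
        by_cases h : φ.Sat w (Function.update env x i)
        · refine ⟨i + 1, by omega, (Does.loopStep rfl (step i (by omega))
            (Does.loopDone (by simp [h]))).of_eq (by rw [Nat.add_mul]; omega) ?_ rfl⟩
          refine Prod.ext (Bool.eq_iff_iff.mpr ?_) (Prod.ext (by simp [h]) rfl)
          simp only [decide_eq_true_eq]
          exact ⟨fun h => ⟨i, le_rfl, by omega, h⟩, fun _ => h⟩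
        · obtain ⟨k, hk, hd⟩ := ih (i + 1) (by omega)
          have hi' : i < w.length := by omega
          have hst := step i (by omega)
          simp only [h, hi', not_false_eq_true, and_self, decide_true, decide_false] at hst
          refine ⟨k, hk, (Does.loopStep rfl hst hd).of_eq
            (by rw [Nat.add_mul (d + 1) 1]; omega) ?_ rfl⟩
          refine Prod.ext (Bool.eq_iff_iff.mpr ?_) rfl
          simp only [decide_eq_true_eq]
          refine ⟨fun ⟨j, h₁, h₂⟩ => ⟨j, by omega, h₂⟩, fun ⟨j, h₁, h₂, h₃⟩ => ⟨j, ?_, h₂, h₃⟩⟩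
          rcases h₁.eq_or_lt with rfl | h₁
          · exact absurd h₃ h
          · exact h₁
    obtain ⟨k, hk, h⟩ := key w.length 0 (by omega)
    have h₀ : Function.update env x 0 = env := by rw [← hs x hφ.1]; simp
    have hc := does_clear_var (w := w) (O := O) (R := R) (env := Function.update env x k)
      (v := (decide (∃ j, 0 ≤ j ∧ j ≤ w.length ∧ φ.Sat w (Function.update env x j)), false, none, none))
      x (L := w.length + 1) (by simpa using hk)
    rw [Function.update_idem, h₀] at hc
    rw [h₀] at h
    refine Does.of_eq (p := (Fml.ex x φ).prog) ((Does.load rfl).seq (h.seq hc)) ?_ ?_ rfl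
    · simp; omega
    · exact Prod.ext (Bool.eq_iff_iff.mpr (by simp only [decide_eq_true_eq]; simp [Fml.Sat])) rfl

/-- As for formulas, except that loops never stop early. The output grows on top of a stack and
therefore appears reversed. -/
theorem Cmd.does_prog (c : Cmd V A B) : ∃ T : Polynomial ℕ, ∀ (w : List A) (env : V → ℕ)
    (s : Finset V) (O R : List B) (v : Ctl A B), c.WF s → (∀ x, env x ≤ w.length) →
      (∀ x ∈ s, env x = 0) →
        Does c.prog v (stk w [] O R 0 env) (T.eval w.length)
          (false, false, none, none) (stk w [] O ((c.output w env).reverse ++ R) 0 env) := by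
  induction c with
  | skip =>
    refine ⟨Polynomial.C 1, ?_⟩
    intro w env s O R v _ _ _
    simpa using! Does.load rfl
  | emit b =>
    refine ⟨Polynomial.C 2, ?_⟩
    intro w env s O R v _ _ _
    exact ((does_push_rev _).seq (Does.load rfl)).of_eq (by simp) rfl rfl
  | ite φ c d ih₁ ih₂ =>
    obtain ⟨T, hT⟩ := φ.does_prog (B := B)
    obtain ⟨T₁, hT₁⟩ := ih₁
    obtain ⟨T₂, hT₂⟩ := ih₂
    refine ⟨T + (Polynomial.C 1 + (T₁ + T₂)), ?_⟩
    intro w env s O R v hφ hL hs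
    refine Does.of_eq (p := (Cmd.ite φ c d).prog) ((hT w env s O R v hφ.1 hL hs).seq (Does.ite
      (T := T₁.eval w.length + T₂.eval w.length)
      (v' := (false, false, none, none))
      (S' := stk w [] O (((Cmd.ite φ c d).output w env).reverse ++ R) 0 env) ?_ ?_)) (by simp) rfl rfl
    · intro h
      have h : φ.Sat w env := by simpa using h
      refine (hT₁ w env s O R _ hφ.2.1 hL hs).of_eq (by omega) rfl ?_
      simp [Cmd.output, h]
    · intro h
      have h : ¬ φ.Sat w env := by simpa using h
      refine (hT₂ w env s O R _ hφ.2.2 hL hs).of_eq (by omega) rfl ?_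
      simp [Cmd.output, h]
  | each x c ih =>
    obtain ⟨T, hT⟩ := ih
    refine ⟨Polynomial.C 1 + ((Polynomial.X + Polynomial.C 1) *
      (T + (Polynomial.C 20 * Polynomial.X + Polynomial.C 20)) + Polynomial.C 1 +
        (Polynomial.C 2 * Polynomial.X + Polynomial.C 4)), ?_⟩
    intro w env s O R v hφ hL hs
    set body : Program V A B :=
      .seq c.prog <|
        .seq (StackProgram.look Option.isSome [x]) <|
        .seq (.load fun v => (false, v.1, none, none)) <|
        .push (.var x) fun _ => () with hbody
    let out : ℕ → List B := fun i =>
      (List.range i).flatMap fun j => c.output w (Function.update env x j)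
    have step : ∀ i < w.length + 1, ((false, decide (i < w.length + 1), none, none) : Ctl A B).2.1 = true ∧
        Does body (false, decide (i < w.length + 1), none, none)
        (stk w [] O ((out i).reverse ++ R) 0 (Function.update env x i))
        (T.eval w.length + (20 * w.length + 10))
        (false, decide (i + 1 < w.length + 1), none, none)
        (stk w [] O ((out (i + 1)).reverse ++ R) 0 (Function.update env x (i + 1))) := by
      intro i hi
      refine ⟨by simpa using hi, ?_⟩
      have hL' := update_le hL (Nat.lt_succ_iff.mp hi) x
      have h₁ := hT w (Function.update env x i) (s.erase x) O ((out i).reverse ++ R)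
        (false, decide (i < w.length + 1), none, none) hφ.2 hL'
        fun y hy => by
          rw [Function.update_of_ne (Finset.ne_of_mem_erase hy)]
          exact hs y (Finset.mem_of_mem_erase hy)
      refine (h₁.seq ((does_look_end x hL' le_rfl).seq ((Does.load rfl).seq
        (does_push_var x)))).of_eq (by omega) (by simp) ?_
      rw [← List.append_assoc, ← List.reverse_append]
      simp [out, List.range_succ]
    have h := Does.loop_count (c := fun v : Ctl A B => v.2.1)
      (fun i => (false, decide (i < w.length + 1), none, none))
      (fun i => stk w [] O ((out i).reverse ++ R) 0 (Function.update env x i)) _ _ step (by simp)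
    have h₀ : Function.update env x 0 = env := by rw [← hs x hφ.1]; simp
    have hc := does_clear_var (w := w) (O := O) (R := (out (w.length + 1)).reverse ++ R)
      (env := Function.update env x (w.length + 1)) (v := (false, false, none, none))
      x (L := w.length + 1) (by simp)
    rw [Function.update_idem, h₀] at hc
    simp only [lt_self_iff_false, decide_false, h₀] at h
    refine Does.of_eq (p := (Cmd.each x c).prog) ((Does.load ?_).seq (h.seq hc)) ?_ rfl rfl
    · simp
    · simp only [Polynomial.eval_add, Polynomial.eval_mul, Polynomial.eval_X, Polynomial.eval_C]
      have : (w.length + 1) * (T.eval w.length + (20 * w.length + 10) + 1) ≤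
        (w.length + 1) * (T.eval w.length + (20 * w.length + 20)) := Nat.mul_le_mul_left _ (by omega)
      omega

omit [Inhabited A] in
-- Reversing the output at the end takes time proportional to its length, which therefore needs a
-- polynomial bound.
theorem Cmd.length_output_le (c : Cmd V A B) : ∃ T : Polynomial ℕ, ∀ (w : List A) (env : V → ℕ),
    (c.output w env).length ≤ T.eval w.length := by
  induction c with
  | skip => exact ⟨0, fun w env => by simp [Cmd.output]⟩
  | emit b => exact ⟨1, fun w env => by simp [Cmd.output]⟩
  | ite φ c d ih₁ ih₂ =>
    obtain ⟨T₁, hT₁⟩ := ih₁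
    obtain ⟨T₂, hT₂⟩ := ih₂
    refine ⟨T₁ + T₂, fun w env => ?_⟩
    have h₁ := hT₁ w env
    have h₂ := hT₂ w env
    rw [Polynomial.eval_add, Cmd.output]
    split <;> omega
  | each x c ih =>
    obtain ⟨T, hT⟩ := ih
    refine ⟨(Polynomial.X + Polynomial.C 1) * T, fun w env => ?_⟩
    rw [Cmd.output, List.length_flatMap]
    refine (List.sum_le_card_nsmul _ (T.eval w.length) ?_).trans (by simp)
    intro n hn
    obtain ⟨i, -, rfl⟩ := List.mem_map.mp hn
    exact hT _ _

/-- The function computed by a command is computable in polynomial time. -/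
theorem Cmd.nonempty_tm2ComputableInPolyTime [Fintype V] [Fintype A] [Fintype B] [Inhabited B]
    (c : Cmd V A B) (hc : c.WF Finset.univ) {α β : Type} {ea : α → List A} {eb : β → List B}
    {f : α → β} (hf : ∀ a, eb (f a) = c.output (ea a) fun _ => 0) :
    Nonempty (Turing.TM2ComputableInPolyTime ea eb f) := by
  obtain ⟨T, hT⟩ := c.does_prog
  obtain ⟨T', hT'⟩ := c.length_output_le
  -- `haltList` requires every stack except the output to be empty and the control state to be the
  -- initial one, so the input is cleared and the reversed output is used up.
  let p : Program V A B := .seq c.prog <| .seq (clear .inp) <| deliver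
  have hp : ∀ a, Does p (false, false, none, none) (stk (ea a) [] [] [] 0 fun _ => 0)
      (T.eval (ea a).length + (2 * (ea a).length + 2 + (3 * T'.eval (ea a).length + 2)))
      (false, false, none, none) (stk [] [] (eb (f a)) [] 0 fun _ => 0) := by
    intro a
    have h₁ := hT (ea a) (fun _ => 0) Finset.univ [] [] (false, false, none, none) hc (by simp)
      (by simp)
    have h₂ : Does (clear .inp) (false, false, none, none)
        (stk (V := V) (ea a) [] [] ((c.output (ea a) fun _ => 0).reverse ++ []) 0 fun _ => 0)
        (2 * (ea a).length + 2) (false, false, none, none)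
        (stk [] [] [] ((c.output (ea a) fun _ => 0).reverse ++ []) 0 fun _ => 0) :=
      (does_clear .inp _).of_eq le_rfl rfl (update_stk_inp [])
    refine (h₁.seq (h₂.seq does_deliver)).of_eq ?_ rfl (by simp [hf])
    have := hT' (ea a) fun _ => 0
    simp only [List.append_nil, List.length_reverse]
    omega
  let := labFintype p
  let M : Option (Lab p) → Turing.TM2.Stmt (Alphabet V A B) (Option (Lab p)) (Ctl A B)
    | none => .halt
    | some l => code p some none l
  let tm : Turing.FinTM2 :=
    { K := Stack V
      k₀ := .inp
      k₁ := .out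
      Γ := Alphabet V A B
      Λ := Option (Lab p)
      main := some (entry p)
      σ := Ctl A B
      initialState := (false, false, none, none)
      Γk₀Fin := inferInstanceAs (Fintype A)
      m := M }
  have hinit : ∀ l : List A, Turing.initList tm l =
      ⟨some (some (entry p)), (false, false, none, none), stk l [] [] [] 0 fun _ => 0⟩ := by
    intro l
    unfold Turing.initList
    congr 1
    funext k
    cases k <;> rfl
  have hhalt : ∀ l : List B, Turing.haltList tm l =
      ⟨none, (false, false, none, none), stk [] [] l [] 0 fun _ => 0⟩ := by
    intro l
    unfold Turing.haltList
    congr 1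
    funext k
    cases k <;> rfl
  refine ⟨{
    tm := tm
    inputAlphabet := Equiv.refl A
    outputAlphabet := Equiv.refl B
    time := T + (2 * Polynomial.X + 2 + (3 * T' + 2)) + 1
    outputsFun := fun a => ?_ }⟩
  have hex : ∃ t ≤ (T + (2 * Polynomial.X + 2 + (3 * T' + 2)) + 1 : Polynomial ℕ).eval
      (ea a).length, (flip bind tm.step)^[t] (some (Turing.initList tm (ea a))) =
        some (Turing.haltList tm (eb (f a))) := by
    obtain ⟨t, ht, hr⟩ := hp a
    -- The additional step executes `.halt` at the exit label.
    refine ⟨1 + t, ?_, ?_⟩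
    · simp; omega
    · rw [Function.iterate_add_apply, hinit, hhalt]
      have := hr.iterate_step (M := M) some none fun _ => rfl
      erw [this]
      rfl
  have h₁ : List.map (Equiv.refl A).invFun (ea a) = ea a := List.map_id _
  have h₂ : List.map (Equiv.refl B).invFun (eb (f a)) = eb (f a) := List.map_id _
  -- `Run` is a proposition, whereas the machine structure wants the number of steps as data.
  refine { steps := hex.choose, evals_in_steps := ?_, steps_le_m := hex.choose_spec.1 }
  have := hex.choose_spec.2
  erw [h₁, h₂]
  exact this

end
end StackProgram

/-! ### Co-occurrence in the dual hypergraph, and certificates -/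

namespace Hypergraph

variable {α : Type*} {H : Hypergraph α}

theorem isTransversal_iff (hV : H.vertexSet = Set.univ) {S : Set α} :
    H.IsTransversal S ↔ ∀ e ∈ H.edgeSet, ∃ x ∈ e, x ∈ S := by
  simp only [IsTransversal, hV, Set.subset_univ, true_and]
  exact forall₂_congr fun e _ => ⟨fun ⟨x, hS, he⟩ => ⟨x, he, hS⟩, fun ⟨x, he, hS⟩ => ⟨x, hS, he⟩⟩

/-- Being a transversal passes to larger sets of vertices, so minimality need only be tested by
deleting single vertices; deleting `v` fails exactly when some hyperedge has no other vertex in `S`.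
-/
theorem minimal_isTransversal_iff (hV : H.vertexSet = Set.univ) {S : Set α} :
    Minimal H.IsTransversal S ↔
      H.IsTransversal S ∧ ∀ v ∈ S, ∃ e ∈ H.edgeSet, ∀ x ∈ e, x ∈ S → x = v := by
  rw [Set.minimal_iff_forall_sdiff_singleton]
  · refine and_congr_right fun _ => forall₂_congr fun v _ => ?_
    rw [isTransversal_iff hV]
    push Not
    simp
  · intro s t ht hts
    rw [isTransversal_iff hV] at ht ⊢
    exact fun e he => (ht e he).imp fun x hx => ⟨hx.1, hts hx.2⟩

/-- For a minimal transversal containing `u` and `v`, take private hyperedges `e` and `f`: apart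
from `u` and `v` it avoids both. Conversely, by finiteness the set on the right contains a minimal
transversal, which must use `u` to meet `e` and `v` to meet `f`. -/
theorem coOccurrenceGraph_dual_adj_iff [Finite α] (hV : H.vertexSet = Set.univ) {u v : α} :
    H.dual.coOccurrenceGraph.Adj u v ↔ ∃ e ∈ H.edgeSet, ∃ f ∈ H.edgeSet,
      u ∈ e ∧ u ∉ f ∧ v ∈ f ∧ v ∉ e ∧
        ∀ g ∈ H.edgeSet, ∃ x ∈ g, (x ∉ e ∧ x ∉ f) ∨ x = u ∨ x = v := by
  constructor
  · rintro ⟨huv, T, hT, hu, hv⟩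
    obtain ⟨ht, hp⟩ := (minimal_isTransversal_iff hV).mp hT
    rw [isTransversal_iff hV] at ht
    obtain ⟨e, he, heu⟩ := hp u hu
    obtain ⟨f, hf, hfv⟩ := hp v hv
    refine ⟨e, he, f, hf, ?_, fun h => huv (hfv u h hu), ?_, fun h => huv (heu v h hv).symm, ?_⟩
    · obtain ⟨x, hx, hxT⟩ := ht e he
      exact heu x hx hxT ▸ hx
    · obtain ⟨x, hx, hxT⟩ := ht f hf
      exact hfv x hx hxT ▸ hx
    · intro g hg
      obtain ⟨x, hx, hxT⟩ := ht g hg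
      refine ⟨x, hx, ?_⟩
      by_cases hxu : x = u
      · exact .inr (.inl hxu)
      · by_cases hxv : x = v
        · exact .inr (.inr hxv)
        · exact .inl ⟨fun h => hxu (heu x h hxT), fun h => hxv (hfv x h hxT)⟩
  · rintro ⟨e, he, f, hf, hue, huf, hvf, hve, h⟩
    let S : Set α := {x | (x ∉ e ∧ x ∉ f) ∨ x = u ∨ x = v}
    have hS : H.IsTransversal S := (isTransversal_iff hV).mpr h
    obtain ⟨T, hTS, hT⟩ := exists_minimal_le_of_wellFoundedLT H.IsTransversal S hS
    have ht := (isTransversal_iff hV).mp hT.prop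
    refine ⟨fun h => huf (h ▸ hvf), T, hT, ?_, ?_⟩
    · obtain ⟨x, hx, hxT⟩ := ht e he
      rcases hTS hxT with h | h | h
      · exact absurd hx h.1
      · exact h ▸ hxT
      · exact absurd (h ▸ hx) hve
    · obtain ⟨x, hx, hxT⟩ := ht f hf
      rcases hTS hxT with h | h | h
      · exact absurd hx h.2
      · exact absurd (h ▸ hx) huf
      · exact h ▸ hxT

end Hypergraph

namespace DualConformality

/-- Subsets of cliques are cliques, so only extensions by one vertex need to be excluded. -/
theorem maximal_isClique_iff {α : Type*} {G : SimpleGraph α} {C : Set α} :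
    Maximal G.IsClique C ↔
      (∀ u ∈ C, ∀ v ∈ C, u ≠ v → G.Adj u v) ∧ ∀ u ∉ C, ∃ v ∈ C, ¬ G.Adj u v := by
  rw [Set.maximal_iff_forall_insert fun s t ht hst => ht.subset hst]
  have hc : G.IsClique C ↔ ∀ u ∈ C, ∀ v ∈ C, u ≠ v → G.Adj u v :=
    ⟨fun h u hu v hv huv => h hu hv huv, fun h u hu v hv huv => h u hu v hv huv⟩
  rw [← hc]
  refine and_congr_right fun h => forall₂_congr fun u hu => ?_
  rw [SimpleGraph.isClique_insert_of_notMem hu]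
  push Not
  exact ⟨fun h' => h' h, fun h' _ => h'⟩

/-- A clique contained in no hyperedge of the dual extends to a maximal clique, which then is no
hyperedge either. Conversely, a hyperedge of the dual containing a maximal clique is itself a
clique, hence equal to it. -/
theorem not_isConformal_dual_iff {n : ℕ} {H : Hypergraph (Fin n)}
    (hV : H.vertexSet = Set.univ) :
    ¬ H.dual.IsConformal ↔ ∃ C : Set (Fin n), IsCertificate H C := by
  constructor
  · intro h
    unfold Hypergraph.IsConformal at h
    push Not at h
    obtain ⟨U, -, hU, hne⟩ := h
    have hc : H.dual.coOccurrenceGraph.IsClique U := fun u hu v hv huv => ⟨huv, hU u hu v hv huv⟩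
    obtain ⟨C, hUC, hC⟩ := exists_maximal_ge_of_wellFoundedGT H.dual.coOccurrenceGraph.IsClique U hc
    exact ⟨C, hC, fun hmin => hne C hmin hUC⟩
  · rintro ⟨C, hC, hmin⟩ h
    obtain ⟨e, he, hCe⟩ := h C (by simp [Hypergraph.dual, hV])
      fun u hu v hv huv => (hC.prop hu hv huv).2
    have hec : H.dual.coOccurrenceGraph.IsClique e := fun u hu v hv huv => ⟨huv, e, he, hu, hv⟩
    rw [hC.eq_of_subset hec hCe] at hmin
    exact hmin he

/-- This is the form that `cliqueF`, `maximalF` and `notMinimalF` transcribe: all quantifiers range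
over vertices and hyperedges. -/
theorem isCertificate_iff {n : ℕ} {H : Hypergraph (Fin n)} (hV : H.vertexSet = Set.univ)
    {C : Set (Fin n)} :
    IsCertificate H C ↔
      (∀ u ∈ C, ∀ v ∈ C, u ≠ v → H.dual.coOccurrenceGraph.Adj u v) ∧
      (∀ u ∉ C, ∃ v ∈ C, ¬ H.dual.coOccurrenceGraph.Adj u v) ∧
      ((∃ e ∈ H.edgeSet, ∀ x ∈ e, x ∉ C) ∨
        ∃ v ∈ C, ∀ e ∈ H.edgeSet, ∃ x ∈ e, x ∈ C ∧ x ≠ v) := by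
  rw [IsCertificate, maximal_isClique_iff, Hypergraph.minimal_isTransversal_iff hV,
    Hypergraph.isTransversal_iff hV, and_assoc, not_and_or]
  push Not
  rfl

end DualConformality

namespace DualConformality

/-! ### Words that list sets -/

/-- The set whose characteristic vector starts at position `e` of the word `w`. -/
def rowSet (w : List (Option Bool)) (n e : ℕ) : Set (Fin n) :=
  {v | w[e + v]? = some (some true)}

/-- The first separator of `w` is at position `n`. -/
def IsFirstSep (w : List (Option Bool)) (n : ℕ) : Prop :=
  w[n]? = some none ∧ ∀ k < n, w[k]? ≠ some none

theorem IsFirstSep.unique {w : List (Option Bool)} {m n : ℕ} (hm : IsFirstSep w m)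
    (hn : IsFirstSep w n) : m = n := by
  rcases lt_trichotomy m n with h | h | h
  · exact absurd hm.1 (hn.2 m h)
  · exact h
  · exact absurd hn.1 (hm.2 n h)

theorem IsFirstSep.lt_length {w : List (Option Bool)} {n : ℕ} (h : IsFirstSep w n) :
    n < w.length :=
  (List.getElem?_eq_some_iff.mp h.1).1

/-- The positions from which `w` lists characteristic vectors of length `n` give exactly the hyperedges of
`H`. -/
structure Presents {n : ℕ} (w : List (Option Bool)) (H : Hypergraph (Fin n)) : Prop where
  first : IsFirstSep w n
  mem_edgeSet : ∀ s, s ∈ H.edgeSet ↔ ∃ e, w[e + n]? = some none ∧ s = rowSet w n e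

section

variable {n : ℕ}

theorem length_bits (s : Set (Fin n)) : (bits s).length = n := by simp [bits]

open scoped Classical in
theorem getElem?_bits (s : Set (Fin n)) (v : Fin n) : (bits s)[(v : ℕ)]? = some (decide (v ∈ s)) := by
  simp [bits]

theorem bits_eq_iff {s : Set (Fin n)} {d : List Bool} :
    d = bits s ↔ d.length = n ∧ s = {v : Fin n | d[(v : ℕ)]? = some true} := by
  constructor
  · rintro rfl
    refine ⟨length_bits s, ?_⟩
    ext v
    rw [Set.mem_ofPred_eq, getElem?_bits]
    simp
  · rintro ⟨hd, rfl⟩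
    refine List.ext_getElem? fun i => ?_
    by_cases hi : i < n
    · have := getElem?_bits {v : Fin n | d[(v : ℕ)]? = some true} ⟨i, hi⟩
      simp only [Set.mem_ofPred_eq] at this
      rw [this]
      simp [List.getElem?_eq_getElem (show i < d.length by omega)]
    · rw [List.getElem?_eq_none (by omega), List.getElem?_eq_none (by rw [length_bits]; omega)]

theorem setsWord_cons (s : Set (Fin n)) (l : List (Set (Fin n))) :
    setsWord (s :: l) = ((bits s).map some ++ [none]) ++ setsWord l := by
  simp [setsWord]

theorem length_row (s : Set (Fin n)) : ((bits s).map some ++ [none]).length = n + 1 := by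
  simp [length_bits]

theorem length_setsWord (l : List (Set (Fin n))) : (setsWord l).length = l.length * (n + 1) := by
  induction l with
  | nil => simp [setsWord]
  | cons s l ih => rw [setsWord_cons, List.length_append, length_row, ih, List.length_cons]; ring

theorem getElem?_setsWord_cons_add (s : Set (Fin n)) (l : List (Set (Fin n))) (k : ℕ) :
    (setsWord (s :: l))[n + 1 + k]? = (setsWord l)[k]? := by
  rw [setsWord_cons, List.getElem?_append_right (by rw [length_row]; omega), length_row]
  congr 1; omega

open scoped Classical in
theorem getElem?_setsWord_cons_lt (s : Set (Fin n)) (l : List (Set (Fin n))) (v : Fin n) :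
    (setsWord (s :: l))[(v : ℕ)]? = some (some (decide (v ∈ s))) := by
  rw [setsWord_cons, List.getElem?_append_left (by rw [length_row]; omega),
    List.getElem?_append_left (by simp [length_bits]), List.getElem?_map, getElem?_bits]
  rfl

theorem getElem?_setsWord_cons_self (s : Set (Fin n)) (l : List (Set (Fin n))) :
    (setsWord (s :: l))[n]? = some none := by
  rw [setsWord_cons, List.getElem?_append_left (by rw [length_row]; omega),
    List.getElem?_append_right (by simp [length_bits])]
  simp [length_bits]

theorem setsWord_sep_iff (l : List (Set (Fin n))) (k : ℕ) :
    (setsWord l)[k]? = some none ↔ ∃ i < l.length, k = i * (n + 1) + n := by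
  induction l generalizing k with
  | nil => simp [setsWord]
  | cons s l ih =>
    rcases lt_trichotomy k n with hk | rfl | hk
    · have := getElem?_setsWord_cons_lt s l ⟨k, hk⟩
      simp only at this
      rw [this]
      simp only [Option.some.injEq, reduceCtorEq, false_iff, not_exists, not_and]
      intro i _ h
      have : n ≤ k := h ▸ Nat.le_add_left n _
      omega
    · rw [getElem?_setsWord_cons_self]
      simp only [true_iff]
      exact ⟨0, by simp, by simp⟩
    · obtain ⟨j, rfl⟩ := Nat.exists_eq_add_of_le (show n + 1 ≤ k from hk)
      rw [getElem?_setsWord_cons_add, ih]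
      constructor
      · rintro ⟨i, hi, rfl⟩
        exact ⟨i + 1, by simpa using hi, by ring⟩
      · rintro ⟨i, hi, h⟩
        cases i with
        | zero => omega
        | succ i => exact ⟨i, by simpa using hi, by rw [Nat.add_mul] at h; omega⟩

theorem rowSet_setsWord (l : List (Set (Fin n))) (i : ℕ) (hi : i < l.length) :
    rowSet (setsWord l) n (i * (n + 1)) = l[i] := by
  induction l generalizing i with
  | nil => simp at hi
  | cons s l ih =>
    ext v
    cases i with
    | zero =>
      have := getElem?_setsWord_cons_lt s l v
      simp [rowSet, this]
    | succ i =>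
      have h := getElem?_setsWord_cons_add s l (i * (n + 1) + v)
      rw [List.getElem_cons_succ, ← ih i (by simpa using hi), rowSet, rowSet, Set.mem_ofPred_eq,
        Set.mem_ofPred_eq, ← h, show (i + 1) * (n + 1) + v = n + 1 + (i * (n + 1) + v) by ring]

/-- A separator at `e + n` closes a row of `n + 1` letters, so `e` is necessarily the start of that
row. The list must be nonempty for a first separator to exist. -/
theorem presents_setsWord {l : List (Set (Fin n))} {H : Hypergraph (Fin n)} (hpos : 0 < l.length)
    (hl : ∀ e, e ∈ l ↔ e ∈ H.edgeSet) : Presents (setsWord l) H := by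
  refine ⟨⟨(setsWord_sep_iff l n).mpr ⟨0, hpos, by simp⟩, fun k hk h => ?_⟩, fun s => ?_⟩
  · obtain ⟨i, -, rfl⟩ := (setsWord_sep_iff l k).mp h
    omega
  · rw [← hl, List.mem_iff_getElem]
    constructor
    · rintro ⟨i, hi, rfl⟩
      exact ⟨i * (n + 1), (setsWord_sep_iff l _).mpr ⟨i, hi, rfl⟩, (rowSet_setsWord l i hi).symm⟩
    · rintro ⟨e, he, rfl⟩
      obtain ⟨i, hi, h⟩ := (setsWord_sep_iff l _).mp he
      obtain rfl : e = i * (n + 1) := by omega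
      exact ⟨i, hi, (rowSet_setsWord l i hi).symm⟩

theorem length_pos_of_isInstance {l : List (Set (Fin n))} {H : Hypergraph (Fin n)}
    (hH : H.IsInstance) (hl : ∀ e, e ∈ l ↔ e ∈ H.edgeSet) : 0 < l.length := by
  obtain ⟨e, he, -⟩ := hH.exists_mem_edge ⟨0, hH.pos⟩
  exact List.length_pos_of_mem ((hl e).mpr he)

theorem Encodes.presents {w : List (Option Bool)} {H : Hypergraph (Fin n)} (h : Encodes w H)
    (hH : H.IsInstance) : Presents w H := by
  obtain ⟨l, hl, rfl⟩ := h
  exact presents_setsWord (length_pos_of_isInstance hH hl) hl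

theorem Presents.eq {w : List (Option Bool)} {H H' : Hypergraph (Fin n)} (h : Presents w H)
    (h' : Presents w H') (hV : H.vertexSet = Set.univ) (hV' : H'.vertexSet = Set.univ) : H = H' := by
  ext s
  · rw [hV, hV']
  · rw [h.mem_edgeSet, h'.mem_edgeSet]

/-! ### Recognising words that list sets by the period of their separators -/

/-- The separators of `w` recur with period `n + 1`, and the last letter is a separator. -/
def IsPeriodic (w : List (Option Bool)) (n : ℕ) : Prop :=
  (∀ k : ℕ, (w[k + (n + 1)]?).isSome → (w[k + (n + 1)]? = some none ↔ w[k]? = some none)) ∧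
    ∃ k : ℕ, w[k]? = some none ∧ ∀ j, k < j → w[j]? = none

theorem isPeriodic_setsWord {l : List (Set (Fin n))} (hl : 0 < l.length) :
    IsPeriodic (setsWord l) n := by
  refine ⟨fun k hk => ?_, (l.length - 1) * (n + 1) + n, ?_, fun j hj => ?_⟩
  · rw [setsWord_sep_iff, setsWord_sep_iff]
    have hk : k + (n + 1) < l.length * (n + 1) := by
      rw [← length_setsWord]
      by_contra hc
      simp [List.getElem?_eq_none (not_lt.mp hc)] at hk
    constructor
    · rintro ⟨i, hi, h⟩
      cases i with
      | zero => omega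
      | succ i => exact ⟨i, by omega, by rw [Nat.add_mul] at h; omega⟩
    · rintro ⟨i, hi, rfl⟩
      refine ⟨i + 1, ?_, by ring⟩
      have : (i + 1) * (n + 1) < l.length * (n + 1) := by
        have : (i + 1) * (n + 1) = i * (n + 1) + (n + 1) := by ring
        omega
      exact lt_of_mul_lt_mul_right this (Nat.zero_le _)
  · exact (setsWord_sep_iff _ _).mpr ⟨_, by omega, rfl⟩
  · refine List.getElem?_eq_none ?_
    rw [length_setsWord]
    obtain ⟨m, hm⟩ : ∃ m, l.length = m + 1 := ⟨l.length - 1, by omega⟩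
    rw [hm] at hj ⊢
    rw [Nat.add_sub_cancel] at hj
    rw [Nat.add_mul]
    omega

/-- Induction on the length: the letters before the first separator are `n` bits, so the first `n +
1` letters form a row, and what follows is empty or satisfies the same hypotheses. -/
theorem IsPeriodic.exists_eq_setsWord {w : List (Option Bool)} (h : IsPeriodic w n)
    (hf : IsFirstSep w n) : ∃ l : List (Set (Fin n)), w = setsWord l := by
  induction hw : w.length using Nat.strong_induction_on generalizing w with
  | _ N ih =>
    have hn := hf.lt_length
    have htake : w.take (n + 1) = (bits (rowSet w n 0)).map some ++ [none] := by
      refine List.ext_getElem? fun i => ?_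
      rcases lt_trichotomy i n with hi | rfl | hi
      · rw [List.getElem?_take_of_lt (by omega), List.getElem?_append_left (by simpa [length_bits]),
          List.getElem?_map, getElem?_bits _ ⟨i, hi⟩]
        have h1 := hf.2 i hi
        rw [List.getElem?_eq_getElem (by omega)] at h1 ⊢
        cases hb : w[i] with
        | none => simp [hb] at h1
        | some b =>
          have : w[i]? = some (some b) := by rw [List.getElem?_eq_getElem (by omega), hb]
          cases b <;> simp [rowSet, this]
      · rw [List.getElem?_take_of_lt (by omega), hf.1,
          List.getElem?_append_right (by simp [length_bits])]
        simp [length_bits]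
      · rw [List.getElem?_eq_none (by simp; omega), List.getElem?_eq_none (by simp [length_bits]; omega)]
    have hdrop : ∀ k, (w.drop (n + 1))[k]? = w[k + (n + 1)]? := fun k => by
      rw [List.getElem?_drop, Nat.add_comm]
    rcases (w.drop (n + 1)).eq_nil_or_concat' with hnil | hne
    · refine ⟨[rowSet w n 0], ?_⟩
      rw [setsWord_cons, ← htake, ← List.take_append_drop (n + 1) w, hnil]
      simp [setsWord]
    · have hlt : n + 1 < w.length := by
        obtain ⟨L, b, hL⟩ := hne
        have := congrArg List.length hL
        simp at this
        omega
      obtain ⟨hper, k, hk, hlast⟩ := h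
      have hfirst : IsFirstSep (w.drop (n + 1)) n := by
        have hper₁ : ∀ j, w[j + (n + 1)]? = some none → w[j]? = some none := fun j hj =>
          (hper j (by simp [hj])).mp hj
        refine ⟨?_, fun j hj hs => hf.2 j hj (hper₁ j (by rw [← hdrop, hs]))⟩
        have hkl := (List.getElem?_eq_some_iff.mp hk).1
        have h₁ : n + 1 ≤ k := by
          by_contra hc
          have := hlast (n + 1) (by omega)
          rw [List.getElem?_eq_none_iff] at this
          omega
        obtain ⟨j, rfl⟩ := Nat.exists_eq_add_of_le' h₁
        -- Moved back by one period, the last separator is still a separator, so it is not before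
        -- `n`. Hence position `n + (n + 1)` lies in the word, and periodicity puts a separator
        -- there.
        have h₂ : n ≤ j := by
          by_contra hc
          exact hf.2 j (by omega) (hper₁ j hk)
        rw [hdrop, hper n, hf.1]
        rw [List.getElem?_eq_getElem (by omega)]
        rfl
      have hper' : IsPeriodic (w.drop (n + 1)) n := by
        refine ⟨fun j hj => ?_, k - (n + 1), ?_, fun j hj => ?_⟩
        · rw [hdrop] at hj
          rw [hdrop, hdrop]
          exact hper _ hj
        · rw [hdrop, ← hk]
          congr 1
          have : n + 1 ≤ k := by
            by_contra hc
            have := hlast (n + 1) (by omega)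
            rw [List.getElem?_eq_none_iff] at this
            omega
          omega
        · rw [hdrop]
          exact hlast _ (by omega)
      obtain ⟨l, hl⟩ := ih (w.drop (n + 1)).length (by simp; omega) hper' hfirst rfl
      exact ⟨rowSet w n 0 :: l, by rw [setsWord_cons, ← htake, ← hl, List.take_append_drop]⟩

end

end DualConformality

namespace StackProgram

/-! ### Polynomial time from formulas -/

theorem Fml.polyTimeDecidable {V A : Type} [DecidableEq V] [Fintype V] [Fintype A] [Inhabited A]
    (φ : Fml V A) (hφ : φ.WF Finset.univ) {α : Type} {enc : α → List A} {P : α → Prop}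
    (h : ∀ a, φ.Sat (enc a) (fun _ => 0) ↔ P a) : Complexity.PolyTimeDecidable enc P := by
  classical
  refine ⟨fun a => decide (P a), fun a => by simp, ?_⟩
  refine (Cmd.ite φ (.emit true) (.emit false)).nonempty_tm2ComputableInPolyTime
    ⟨hφ, trivial, trivial⟩ fun a => ?_
  by_cases hP : P a
  · simp [Cmd.output, h, hP, Computability.encodeBool]
  · simp [Cmd.output, h, hP, Computability.encodeBool]

namespace Fml

variable {V A : Type}

/-- Disjunction. -/
def or (φ ψ : Fml V A) : Fml V A := .not (.and (.not φ) (.not ψ))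

/-- Universal quantification. -/
def all (x : V) (φ : Fml V A) : Fml V A := .not (.ex x (.not φ))

/-- Implication. -/
def imp (φ ψ : Fml V A) : Fml V A := .not (.and φ (.not ψ))

/-- Equality of two variables. -/
def eq (x y : V) : Fml V A := .and (.not (.less x y)) (.not (.less y x))

variable [DecidableEq V] {W : List A} {env : V → ℕ} {φ ψ : Fml V A}

@[simp] theorem sat_look {p : Option A → Bool} {xs : List V} :
    (Fml.look p xs).Sat W env ↔ p W[(xs.map env).sum]? = true := Iff.rfl

@[simp] theorem sat_less {x y : V} : (Fml.less x y : Fml V A).Sat W env ↔ env x < env y := Iff.rfl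

@[simp] theorem sat_not : φ.not.Sat W env ↔ ¬ φ.Sat W env := Iff.rfl

@[simp] theorem sat_and : (φ.and ψ).Sat W env ↔ φ.Sat W env ∧ ψ.Sat W env := Iff.rfl

@[simp] theorem sat_ex {x : V} :
    (Fml.ex x φ).Sat W env ↔ ∃ i ≤ W.length, φ.Sat W (Function.update env x i) := Iff.rfl

@[simp] theorem sat_or : (φ.or ψ).Sat W env ↔ φ.Sat W env ∨ ψ.Sat W env := by
  simp [or]; tauto

@[simp] theorem sat_imp : (φ.imp ψ).Sat W env ↔ (φ.Sat W env → ψ.Sat W env) := by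
  simp [imp]

@[simp] theorem sat_all {x : V} :
    (φ.all x).Sat W env ↔ ∀ i ≤ W.length, φ.Sat W (Function.update env x i) := by
  simp [all]

@[simp] theorem sat_eq {x y : V} : (Fml.eq x y : Fml V A).Sat W env ↔ env x = env y := by
  simp [eq]; omega

end Fml

end StackProgram

namespace DualConformality

open StackProgram

/-! ### Formulas about hypergraphs

Variable `0` holds the number of vertices, `1` and `2` hold vertices, `3`, `4` and `5` hyperedges,
`6` a further vertex or position, and `7` the position at which the certificate starts. -/

section

variable {A : Type}

/-- The letter is a separator of the list of hyperedges, where `δ` extracts this list. -/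
def sepF (δ : Option A → Option (Option Bool)) (xs : List (Fin 10)) : Fml (Fin 10) A :=
  .look (fun a => δ a = some none) xs

/-- The letter is a `1` in the list of hyperedges. -/
def oneF (δ : Option A → Option (Option Bool)) (xs : List (Fin 10)) : Fml (Fin 10) A :=
  .look (fun a => δ a = some (some true)) xs

/-- Some hyperedge. -/
def exEdge (δ : Option A → Option (Option Bool)) (e : Fin 10) (φ : Fml (Fin 10) A) :
    Fml (Fin 10) A :=
  .ex e (.and (sepF δ [e, 0]) φ)

/-- Every hyperedge. -/
def allEdge (δ : Option A → Option (Option Bool)) (e : Fin 10) (φ : Fml (Fin 10) A) :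
    Fml (Fin 10) A :=
  .not (exEdge δ e (.not φ))

/-- Some vertex. -/
def exVertex (x : Fin 10) (φ : Fml (Fin 10) A) : Fml (Fin 10) A := .ex x (.and (.less x 0) φ)

/-- Every vertex. -/
def allVertex (x : Fin 10) (φ : Fml (Fin 10) A) : Fml (Fin 10) A := .not (exVertex x (.not φ))

/-- The first separator is at position `0`. -/
def firstSepF (δ : Option A → Option (Option Bool)) : Fml (Fin 10) A :=
  .and (sepF δ [0]) (.not (exVertex 6 (sepF δ [6])))

/-- Adjacency of `1` and `2` in the co-occurrence graph of the dual. -/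
def adjF (δ : Option A → Option (Option Bool)) : Fml (Fin 10) A :=
  exEdge δ 3 <| exEdge δ 4 <|
    .and (oneF δ [3, 1]) <| .and (.not (oneF δ [4, 1])) <|
    .and (oneF δ [4, 2]) <| .and (.not (oneF δ [3, 2])) <|
    allEdge δ 5 <| exVertex 6 <| .and (oneF δ [5, 6]) <|
      .or (.and (.not (oneF δ [3, 6])) (.not (oneF δ [4, 6]))) (.or (.eq 6 1) (.eq 6 2))

/-- The separators recur periodically, and the last letter is a separator. -/
def periodicF (δ : Option A → Option (Option Bool)) : Fml (Fin 10) A :=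
  -- Variable `8` is forced to be `n + 1`: it exceeds variable `0` with no position strictly
  -- between.
  .ex 8 <| .and (.less 0 8) <| .and (.not (.ex 6 (.and (.less 0 6) (.less 6 8)))) <|
    .and (.all 6 (.imp (.look (fun a => (δ a).isSome) [6, 8])
      (.and (.imp (sepF δ [6, 8]) (sepF δ [6])) (.imp (sepF δ [6]) (sepF δ [6, 8])))))
    (.ex 6 (.and (sepF δ [6])
      (.not (.ex 9 (.and (.less 6 9) (.look (fun a => (δ a).isSome) [9]))))))

/-- The word represents a hypergraph in which every vertex belongs to a hyperedge. -/
def instanceF (δ : Option A → Option (Option Bool)) : Fml (Fin 10) A :=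
  .and (firstSepF δ) <| .and (.ex 6 (.less 6 0)) <| .and (periodicF δ) <|
    allVertex 1 (exEdge δ 3 (oneF δ [3, 1]))

/-! ### Meaning of the hypergraph formulas -/

/-- `W` contains the list `w` of hyperedges, which `δ` extracts. -/
structure Reads (δ : Option A → Option (Option Bool)) (W : List A) (w : List (Option Bool)) :
    Prop where
  letter : ∀ i : ℕ, δ W[i]? = w[i]?
  length_le : w.length ≤ W.length

variable {δ : Option A → Option (Option Bool)} {W : List A} {w : List (Option Bool)}
  {env : Fin 10 → ℕ} {n : ℕ} {H : Hypergraph (Fin n)}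

theorem Reads.sat_sepF (hr : Reads δ W w) {xs : List (Fin 10)} :
    (sepF δ xs).Sat W env ↔ w[(xs.map env).sum]? = some none := by
  simp [sepF, hr.letter]

theorem Reads.sat_oneF (hr : Reads δ W w) {xs : List (Fin 10)} :
    (oneF δ xs).Sat W env ↔ w[(xs.map env).sum]? = some (some true) := by
  simp [oneF, hr.letter]

theorem sat_exVertex (h0 : env 0 = n) (hn : n ≤ W.length) {x : Fin 10} (hx : x ≠ 0)
    {φ : Fml (Fin 10) A} :
    (exVertex x φ).Sat W env ↔ ∃ v : Fin n, φ.Sat W (Function.update env x v) := by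
  simp only [exVertex, Fml.sat_ex, Fml.sat_and, Fml.sat_less, Function.update_self,
    Function.update_of_ne hx.symm, h0]
  exact ⟨fun ⟨i, _, hi, h⟩ => ⟨⟨i, hi⟩, h⟩, fun ⟨v, h⟩ => ⟨v, by omega, v.2, h⟩⟩

theorem sat_allVertex (h0 : env 0 = n) (hn : n ≤ W.length) {x : Fin 10} (hx : x ≠ 0)
    {φ : Fml (Fin 10) A} :
    (allVertex x φ).Sat W env ↔ ∀ v : Fin n, φ.Sat W (Function.update env x v) := by
  simp [allVertex, sat_exVertex h0 hn hx]

/-- Repeated hyperedges have several starting positions; this is harmless because the body depends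
on the position only through the set `rowSet w n i`. -/
theorem Reads.sat_exEdge (hr : Reads δ W w) (hP : Presents w H) (h0 : env 0 = n) {e : Fin 10}
    (he : e ≠ 0) {φ : Fml (Fin 10) A} {Q : Set (Fin n) → Prop}
    (h : ∀ i, φ.Sat W (Function.update env e i) ↔ Q (rowSet w n i)) :
    (exEdge δ e φ).Sat W env ↔ ∃ s ∈ H.edgeSet, Q s := by
  simp only [exEdge, Fml.sat_ex, Fml.sat_and, hr.sat_sepF, h, hP.mem_edgeSet]
  simp only [List.map_cons, List.map_nil, List.sum_cons, List.sum_nil, Function.update_self,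
    Function.update_of_ne he.symm, h0, add_zero]
  constructor
  · rintro ⟨i, -, hi, hQ⟩
    exact ⟨_, ⟨i, hi, rfl⟩, hQ⟩
  · rintro ⟨_, ⟨i, hi, rfl⟩, hQ⟩
    have := (List.getElem?_eq_some_iff.mp hi).1
    have := hr.length_le
    exact ⟨i, by omega, hi, hQ⟩

theorem Reads.sat_allEdge (hr : Reads δ W w) (hP : Presents w H) (h0 : env 0 = n) {e : Fin 10}
    (he : e ≠ 0) {φ : Fml (Fin 10) A} {Q : Set (Fin n) → Prop}
    (h : ∀ i, φ.Sat W (Function.update env e i) ↔ Q (rowSet w n i)) :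
    (allEdge δ e φ).Sat W env ↔ ∀ s ∈ H.edgeSet, Q s := by
  rw [allEdge, Fml.sat_not, hr.sat_exEdge hP h0 he (Q := fun s => ¬ Q s) fun i => by simp [h]]
  push Not
  rfl

theorem Reads.sat_firstSepF (hr : Reads δ W w) :
    (firstSepF δ).Sat W env ↔ IsFirstSep w (env 0) := by
  simp only [firstSepF, Fml.sat_and, Fml.sat_not, IsFirstSep, hr.sat_sepF]
  simp only [List.map_cons, List.map_nil, List.sum_cons, List.sum_nil, add_zero]
  refine and_congr_right fun h => ?_
  have h₁ := (List.getElem?_eq_some_iff.mp h).1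
  have h₂ := hr.length_le
  rw [sat_exVertex rfl (by omega) (by decide)]
  simp only [hr.sat_sepF]
  simp only [List.map_cons, List.map_nil, List.sum_cons, List.sum_nil, add_zero,
    Function.update_self]
  push Not
  exact ⟨fun h k hk => h ⟨k, hk⟩, fun h v => h v v.2⟩

theorem Reads.sat_adjF (hr : Reads δ W w) (hP : Presents w H) (hV : H.vertexSet = Set.univ)
    (h0 : env 0 = n) {u v : Fin n} (h1 : env 1 = u) (h2 : env 2 = v) :
    (adjF δ).Sat W env ↔ H.dual.coOccurrenceGraph.Adj u v := by
  have hn : n ≤ W.length := hP.first.lt_length.le.trans hr.length_le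
  rw [H.coOccurrenceGraph_dual_adj_iff hV, adjF]
  refine hr.sat_exEdge hP h0 (by decide) (Q := fun e => ∃ f ∈ H.edgeSet,
      u ∈ e ∧ u ∉ f ∧ v ∈ f ∧ v ∉ e ∧
        ∀ g ∈ H.edgeSet, ∃ x ∈ g, (x ∉ e ∧ x ∉ f) ∨ x = u ∨ x = v) fun i => ?_
  refine hr.sat_exEdge hP (by simpa) (by decide) (Q := fun f =>
      u ∈ rowSet w n i ∧ u ∉ f ∧ v ∈ f ∧ v ∉ rowSet w n i ∧
        ∀ g ∈ H.edgeSet, ∃ x ∈ g, (x ∉ rowSet w n i ∧ x ∉ f) ∨ x = u ∨ x = v) fun j => ?_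
  simp only [Fml.sat_and, Fml.sat_not, hr.sat_oneF]
  rw [hr.sat_allEdge hP (by simpa) (by decide) (Q := fun g =>
    ∃ x ∈ g, (x ∉ rowSet w n i ∧ x ∉ rowSet w n j) ∨ x = u ∨ x = v)]
  · simp [rowSet, h1, h2]
  · intro k
    rw [sat_exVertex (by simpa) hn (by decide)]
    simp [hr.sat_oneF, rowSet, h1, h2, Fin.val_inj]

theorem Reads.sat_periodicF (hr : Reads δ W w) (h0 : env 0 = n) (hn : n < W.length) :
    (periodicF δ).Sat W env ↔ IsPeriodic w n := by
  -- Quantified variables take values up to `|W|` only; `n < W.length` makes `n + 1` available as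
  -- such a value.
  have hsucc : ∀ m ≤ W.length, (n < m ∧ ¬ ∃ i ≤ W.length, n < i ∧ i < m) ↔ m = n + 1 := by
    intro m hm
    constructor
    · rintro ⟨h₁, h₂⟩
      by_contra h
      exact h₂ ⟨n + 1, by omega, by omega, by omega⟩
    · rintro rfl
      exact ⟨by omega, by rintro ⟨i, -, h₁, h₂⟩; omega⟩
  have hlt : ∀ {k : ℕ}, w[k]?.isSome → k ≤ W.length := by
    intro k hk
    have h₁ : k < w.length := by simpa using hk
    exact h₁.le.trans hr.length_le
  simp only [periodicF, Fml.sat_ex, Fml.sat_and, Fml.sat_not, Fml.sat_less, Fml.sat_all,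
    Fml.sat_imp, hr.sat_sepF, Fml.sat_look, hr.letter, List.map_cons, List.map_nil, List.sum_cons,
    List.sum_nil, add_zero, Function.update_self, ne_eq, Fin.reduceEq, not_false_eq_true,
    Function.update_of_ne, h0, IsPeriodic]
  constructor
  · rintro ⟨m, hm, h₁, h₂, h₃, k, hk, hs, hend⟩
    obtain rfl := (hsucc m hm).mp ⟨h₁, h₂⟩
    refine ⟨fun j hj => ?_, k, hs, fun j hj => ?_⟩
    · have := h₃ j ((Nat.le_add_right _ _).trans (hlt hj)) hj
      exact ⟨this.1, this.2⟩
    · by_contra hne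
      have hj' : w[j]?.isSome := Option.isSome_iff_ne_none.mpr hne
      exact hend ⟨j, hlt hj', hj, hj'⟩
  · rintro ⟨h₃, k, hs, hend⟩
    have h := (hsucc (n + 1) hn).mpr rfl
    refine ⟨n + 1, hn, h.1, h.2, fun j _ hj => ⟨(h₃ j hj).1, (h₃ j hj).2⟩, k, hlt (by simp [hs]), hs, ?_⟩
    rintro ⟨j, -, hj, h⟩
    simp [hend j hj] at h

theorem Reads.sat_cover (hr : Reads δ W w) (hP : Presents w H) (h0 : env 0 = n) :
    (allVertex 1 (exEdge δ 3 (oneF δ [3, 1]))).Sat W env ↔ ∀ v : Fin n, ∃ e ∈ H.edgeSet, v ∈ e := by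
  rw [sat_allVertex h0 (hP.first.lt_length.le.trans hr.length_le) (by decide)]
  refine forall_congr' fun v => ?_
  refine hr.sat_exEdge hP (by simpa) (by decide) (Q := fun e => v ∈ e) fun i => ?_
  simp [hr.sat_oneF, rowSet]

theorem Reads.sat_instanceF (hr : Reads δ W w) (h0 : env 0 = n) :
    (instanceF δ).Sat W env ↔ ∃ H : Hypergraph (Fin n), H.IsInstance ∧ Encodes w H := by
  simp only [instanceF, Fml.sat_and, hr.sat_firstSepF, h0]
  constructor
  · rintro ⟨hf, hpos, hper, hcov⟩
    rw [hr.sat_periodicF h0 (hf.lt_length.trans_le hr.length_le)] at hper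
    obtain ⟨l, rfl⟩ := hper.exists_eq_setsWord hf
    let H : Hypergraph (Fin n) := ⟨Set.univ, {s | s ∈ l}, fun _ _ => Set.subset_univ _⟩
    have hl : ∀ e, e ∈ l ↔ e ∈ H.edgeSet := fun _ => Iff.rfl
    have hP : Presents (setsWord l) H := by
      refine presents_setsWord (List.length_pos_iff.mpr ?_) hl
      rintro rfl
      simpa [setsWord] using hf.lt_length
    refine ⟨H, ⟨?_, rfl, (hr.sat_cover hP h0).mp hcov⟩, l, hl, rfl⟩
    obtain ⟨i, -, hi⟩ := hpos
    simp [h0] at hi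
    omega
  · rintro ⟨H, hH, hE⟩
    have hP := hE.presents hH
    refine ⟨hP.first, ⟨0, by simp, by simpa [h0] using hH.pos⟩, ?_,
      (hr.sat_cover hP h0).mpr hH.exists_mem_edge⟩
    rw [hr.sat_periodicF h0 (hP.first.lt_length.trans_le hr.length_le)]
    obtain ⟨l, hl, rfl⟩ := hE
    exact isPeriodic_setsWord (length_pos_of_isInstance hH hl)

end

end DualConformality

namespace DualConformality

open StackProgram

/-! ### Formulas about certificates -/

/-- The list of hyperedges in a word that presents a pair. -/
def fstLetter : Option (Option Bool ⊕ Bool) → Option (Option Bool)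
  | some (.inl a) => some a
  | _ => none

/-- The certificate in a word that presents a pair. -/
def sndLetter : Option (Option Bool ⊕ Bool) → Option Bool
  | some (.inr b) => some b
  | _ => none

theorem reads_pairWord (w : List (Option Bool)) (d : List Bool) :
    Reads fstLetter (Complexity.pairWord (w, d)) w where
  letter i := by
    by_cases hi : i < w.length
    · rw [Complexity.pairWord, List.getElem?_append_left (by simpa using hi), List.getElem?_map,
        List.getElem?_eq_getElem hi]
      rfl
    · rw [Complexity.pairWord, List.getElem?_append_right (by simpa using hi),
        List.getElem?_eq_none (not_lt.mp hi), List.getElem?_map]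
      cases d[i - (w.map Sum.inl : List (Option Bool ⊕ Bool)).length]? <;> rfl
  length_le := by simp [Complexity.pairWord]

theorem sndLetter_pairWord (w : List (Option Bool)) (d : List Bool) (i : ℕ) :
    sndLetter (Complexity.pairWord (w, d))[w.length + i]? = d[i]? := by
  rw [Complexity.pairWord, List.getElem?_append_right (by simp), List.getElem?_map]
  simp only [List.length_map, Nat.add_sub_cancel_left]
  cases d[i]? <;> rfl

theorem sndLetter_pairWord_lt (w : List (Option Bool)) (d : List Bool) {i : ℕ} (hi : i < w.length) :
    sndLetter (Complexity.pairWord (w, d))[i]? = none := by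
  rw [Complexity.pairWord, List.getElem?_append_left (by simpa using hi), List.getElem?_map,
    List.getElem?_eq_getElem hi]
  rfl

/-- Position `7` is the first position of the certificate, which is a vector of length `0`. -/
def vectorF : Fml (Fin 10) (Option Bool ⊕ Bool) :=
  .and (.look (fun a => (sndLetter a).isSome) [7]) <|
  .and (.not (.ex 6 (.and (.less 6 7) (.look (fun a => (sndLetter a).isSome) [6])))) <|
  .and (.not (.look (fun a => (sndLetter a).isSome) [7, 0]))
    (allVertex 6 (.look (fun a => (sndLetter a).isSome) [7, 6]))

/-- The vertex `x` belongs to the certificate. -/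
def memF (x : Fin 10) : Fml (Fin 10) (Option Bool ⊕ Bool) :=
  .look (fun a => sndLetter a = some true) [7, x]

/-- The certificate is a clique. -/
def cliqueF : Fml (Fin 10) (Option Bool ⊕ Bool) :=
  allVertex 1 <| allVertex 2 <| .imp (memF 1) <| .imp (memF 2) <|
    .imp (.not (.eq 1 2)) (adjF fstLetter)

/-- The certificate cannot be extended to a larger clique. -/
def maximalF : Fml (Fin 10) (Option Bool ⊕ Bool) :=
  allVertex 1 <| .imp (.not (memF 1)) <| exVertex 2 <| .and (memF 2) (.not (adjF fstLetter))

/-- The certificate is not a minimal transversal. -/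
def notMinimalF : Fml (Fin 10) (Option Bool ⊕ Bool) :=
  .or (exEdge fstLetter 3 <| allVertex 6 <| .imp (oneF fstLetter [3, 6]) (.not (memF 6)))
    (exVertex 1 <| .and (memF 1) <| allEdge fstLetter 3 <| exVertex 6 <|
      .and (oneF fstLetter [3, 6]) (.and (memF 6) (.not (.eq 6 1))))

/-- The word of hyperedges represents a hypergraph. -/
def hypergraphF : Fml (Fin 10) (Option Bool ⊕ Bool) := .ex 0 (instanceF fstLetter)

/-- The pair consists of a word that represents a hypergraph and of a certificate for it. -/
def certificateF : Fml (Fin 10) (Option Bool ⊕ Bool) :=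
  .ex 0 <| .and (instanceF fstLetter) <| .ex 7 <|
    .and vectorF <| .and cliqueF <| .and maximalF notMinimalF

section

variable {w : List (Option Bool)} {d : List Bool} {env : Fin 10 → ℕ} {n : ℕ}

/-- The certificate letters form the final segment of the pair word, so the first of them is at
`w.length`. Positivity of `n` is essential: an empty vector has no first letter. -/
theorem sat_vectorF (h0 : env 0 = n) (hn : n ≤ w.length) (hpos : 0 < n) :
    vectorF.Sat (Complexity.pairWord (w, d)) env ↔ env 7 = w.length ∧ d.length = n := by
  have hW : n ≤ (Complexity.pairWord (w, d)).length := hn.trans (reads_pairWord w d).length_le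
  simp only [vectorF, Fml.sat_and, Fml.sat_not, sat_allVertex h0 hW (show (6 : Fin 10) ≠ 0 by decide)]
  simp only [Fml.sat_ex, Fml.sat_and, Fml.sat_look, Fml.sat_less, List.map_cons, List.map_nil,
    List.sum_cons, List.sum_nil, add_zero, Function.update_self, ne_eq, Fin.reduceEq,
    not_false_eq_true, Function.update_of_ne, h0]
  constructor
  · rintro ⟨h₁, h₂, h₃, h₄⟩
    have h7 : env 7 = w.length := by
      rcases lt_trichotomy (env 7) w.length with h | h | h
      · simp [sndLetter_pairWord_lt w d h] at h₁
      · exact h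
      · refine absurd ⟨w.length, (reads_pairWord w d).length_le, h, ?_⟩ h₂
        have hd : 0 < d.length := by
          obtain ⟨i, hi⟩ := Nat.exists_eq_add_of_lt h
          rw [hi, add_assoc, sndLetter_pairWord] at h₁
          have : i + 1 < d.length := by simpa using h₁
          omega
        have := sndLetter_pairWord w d 0
        rw [add_zero] at this
        rw [this]
        simpa using hd
    refine ⟨h7, ?_⟩
    rw [h7, sndLetter_pairWord] at h₃
    have h₄ := h₄ ⟨n - 1, by omega⟩
    rw [h7, sndLetter_pairWord] at h₄
    simp at h₃ h₄
    omega
  · rintro ⟨h7, hd⟩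
    have h := sndLetter_pairWord w d 0
    rw [add_zero] at h
    rw [h7, h, sndLetter_pairWord]
    refine ⟨by simp; omega, ?_, by simp; omega, fun v => ?_⟩
    · rintro ⟨i, -, hi, h⟩
      simp [sndLetter_pairWord_lt w d hi] at h
    · rw [sndLetter_pairWord]
      simp
      omega

theorem sat_memF (h7 : env 7 = w.length) {x : Fin 10} :
    (memF x).Sat (Complexity.pairWord (w, d)) env ↔ d[env x]? = some true := by
  simp [memF, h7, sndLetter_pairWord]

theorem sat_certificateF_aux {H : Hypergraph (Fin n)} (hP : Presents w H)
    (hV : H.vertexSet = Set.univ) (h0 : env 0 = n) (h7 : env 7 = w.length) :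
    (cliqueF.and (maximalF.and notMinimalF)).Sat (Complexity.pairWord (w, d)) env ↔
      IsCertificate H {v : Fin n | d[(v : ℕ)]? = some true} := by
  have hr := reads_pairWord w d
  have hn : n ≤ (Complexity.pairWord (w, d)).length := hP.first.lt_length.le.trans hr.length_le
  rw [isCertificate_iff hV, Fml.sat_and, Fml.sat_and]
  refine and_congr ?_ (and_congr ?_ ?_)
  · rw [cliqueF, sat_allVertex h0 hn (by decide)]
    refine forall_congr' fun u => ?_
    rw [sat_allVertex (by simpa) hn (by decide)]
    simp only [Fml.sat_imp, Fml.sat_not, Fml.sat_eq, Set.mem_ofPred_eq]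
    have : ∀ v : Fin n, _ := fun v => hr.sat_adjF (u := u) (v := v) hP hV
      (env := Function.update (Function.update env 1 u) 2 v) (by simpa) (by simp) (by simp)
    simp only [this, sat_memF (d := d) (w := w)
      (env := Function.update (Function.update env 1 _) 2 _) (by simpa)]
    simp [Fin.val_inj]
    tauto
  · rw [maximalF, sat_allVertex h0 hn (by decide)]
    refine forall_congr' fun u => ?_
    rw [Fml.sat_imp, sat_exVertex (by simpa) hn (by decide), Fml.sat_not, sat_memF (by simpa)]
    refine imp_congr (by simp) (exists_congr fun v => ?_)
    rw [Fml.sat_and, Fml.sat_not, sat_memF (by simpa), hr.sat_adjF (u := u) (v := v) hP hV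
      (by simpa) (by simp) (by simp)]
    simp
  · rw [notMinimalF, Fml.sat_or]
    refine or_congr ?_ ?_
    · refine hr.sat_exEdge hP h0 (by decide)
        (Q := fun e => ∀ x ∈ e, x ∉ {v : Fin n | d[(v : ℕ)]? = some true}) fun i => ?_
      rw [sat_allVertex (by simpa) hn (by decide)]
      refine forall_congr' fun x => ?_
      rw [Fml.sat_imp, Fml.sat_not, sat_memF (by simpa), hr.sat_oneF]
      simp [rowSet]
    · rw [sat_exVertex h0 hn (by decide)]
      refine exists_congr fun v => ?_
      rw [Fml.sat_and, sat_memF (by simpa)]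
      refine and_congr (by simp) ?_
      refine hr.sat_allEdge hP (by simpa) (by decide)
        (Q := fun e => ∃ x ∈ e, x ∈ {v : Fin n | d[(v : ℕ)]? = some true} ∧ x ≠ v) fun i => ?_
      rw [sat_exVertex (by simpa) hn (by decide)]
      refine exists_congr fun x => ?_
      rw [Fml.sat_and, Fml.sat_and, Fml.sat_not, sat_memF (by simpa), hr.sat_oneF]
      simp [rowSet, Fin.val_inj]

theorem sat_hypergraphF : hypergraphF.Sat (Complexity.pairWord (w, d)) (fun _ => 0) ↔
    ∃ (n : ℕ) (H : Hypergraph (Fin n)), H.IsInstance ∧ Encodes w H := by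
  have hr := reads_pairWord w d
  simp only [hypergraphF, Fml.sat_ex, hr.sat_instanceF (Function.update_self ..)]
  constructor
  · rintro ⟨n, -, h⟩
    exact ⟨n, h⟩
  · rintro ⟨n, H, hH, hE⟩
    exact ⟨n, (hE.presents hH).first.lt_length.le.trans hr.length_le, H, hH, hE⟩

theorem sat_certificateF : certificateF.Sat (Complexity.pairWord (w, d)) (fun _ => 0) ↔
    CertificateRel w d := by
  have hr := reads_pairWord w d
  have hlen := hr.length_le
  simp only [certificateF, Fml.sat_ex, Fml.sat_and, hr.sat_instanceF (Function.update_self ..)]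
  constructor
  · rintro ⟨n, -, ⟨H, hH, hE⟩, m, -, hvec, hbody⟩
    have hP := hE.presents hH
    rw [sat_vectorF (n := n) (by simp) hP.first.lt_length.le hH.pos] at hvec
    exact ⟨n, H, _, hH, hE, bits_eq_iff.mpr ⟨hvec.2, rfl⟩,
      (sat_certificateF_aux hP hH.vertexSet_eq (by simp) hvec.1).mp hbody⟩
  · rintro ⟨n, H, C, hH, hE, hd, hC⟩
    have hP := hE.presents hH
    obtain ⟨hlen', rfl⟩ := bits_eq_iff.mp hd
    refine ⟨n, hP.first.lt_length.le.trans hlen, ⟨H, hH, hE⟩, w.length, hlen, ?_, ?_⟩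
    · exact (sat_vectorF (by simp) hP.first.lt_length.le hH.pos).mpr ⟨by simp, hlen'⟩
    · exact (sat_certificateF_aux hP hH.vertexSet_eq (by simp) (by simp)).mpr hC

end

/-! ### Checking certificates, and membership in co-NP -/

theorem wf_certificateF : certificateF.WF Finset.univ := by
  simp [certificateF, instanceF, firstSepF, periodicF, vectorF, cliqueF, maximalF, notMinimalF,
    memF, adjF, exEdge, allEdge, exVertex, allVertex, sepF, oneF, Fml.WF, Fml.or, Fml.imp, Fml.all,
    Fml.eq]

theorem wf_hypergraphF : hypergraphF.WF Finset.univ := by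
  simp [hypergraphF, instanceF, firstSepF, periodicF, exEdge, allVertex, exVertex, sepF, oneF,
    Fml.WF, Fml.imp, Fml.all]

theorem polyTimeDecidable_certificateRel : Complexity.PolyTimeDecidable Complexity.pairWord
    (fun wc : List (Option Bool) × List Bool => CertificateRel wc.1 wc.2) :=
  certificateF.polyTimeDecidable wf_certificateF fun _ => sat_certificateF

/-- The complement also contains the words that represent no hypergraph, hence the second
alternative. A certificate has length `n < |w|`, so the bound `X` suffices. Soundness uses that a
word determines its hypergraph: the first separator fixes `n`, and the rows fix the hyperedges. -/
theorem coNP_problem : Complexity.CoNP problem := by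
  refine ⟨fun w d => CertificateRel w d ∨
    ¬ ∃ (n : ℕ) (H : Hypergraph (Fin n)), H.IsInstance ∧ Encodes w H, Polynomial.X, ?_, fun w => ?_⟩
  · refine (certificateF.or (.not hypergraphF)).polyTimeDecidable
      ⟨wf_certificateF, wf_hypergraphF⟩ fun a => ?_
    exact Fml.sat_or.trans (or_congr sat_certificateF (not_congr sat_hypergraphF))
  · constructor
    · intro hw
      by_cases h : ∃ (n : ℕ) (H : Hypergraph (Fin n)), H.IsInstance ∧ Encodes w H
      · obtain ⟨n, H, hH, hE⟩ := h
        obtain ⟨C, hC⟩ := (not_isConformal_dual_iff hH.vertexSet_eq).mp fun hc => hw ⟨n, H, hH, hE, hc⟩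
        refine ⟨bits C, ?_, .inl ⟨n, H, C, hH, hE, rfl, hC⟩⟩
        rw [length_bits, Polynomial.eval_X]
        exact (hE.presents hH).first.lt_length.le
      · exact ⟨[], by simp, .inr h⟩
    · rintro ⟨d, -, h⟩ ⟨n, H, hH, hE, hc⟩
      rcases h with ⟨n', H', C, hH', hE', -, hC⟩ | h
      · have hP := hE.presents hH
        have hP' := hE'.presents hH'
        obtain rfl := hP.first.unique hP'.first
        obtain rfl := hP.eq hP' hH.vertexSet_eq hH'.vertexSet_eq
        exact (not_isConformal_dual_iff hH.vertexSet_eq).mpr ⟨C, hC⟩ hc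
      · exact h ⟨n, H, hH, hE⟩

/-! ### Computing the co-occurrence graph -/

/-- The command that writes the adjacency matrix. -/
def graphCmd : Cmd (Fin 10) (Option Bool) (Option Bool) :=
  .each 0 <| .ite (firstSepF id)
    (.each 1 <| .ite (.less 1 0)
      (.each 2 <| .ite (.less 2 0)
        (.ite (adjF id) (.emit (some true)) (.emit (some false)))
        (.ite (.eq 2 0) (.emit none) .skip))
      .skip)
    .skip

theorem wf_graphCmd : graphCmd.WF Finset.univ := by
  simp [graphCmd, Cmd.WF, firstSepF, adjF, exEdge, allEdge, exVertex, sepF, oneF, Fml.WF, Fml.or,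
    Fml.eq]

/-- Loops of commands always run up to `|w|`; this cuts them down to the values that write
something. -/
theorem flatMap_range_of_le {β : Type*} {m L : ℕ} (h : m ≤ L) (g : ℕ → List β)
    (hg : ∀ i, m ≤ i → g i = []) : (List.range L).flatMap g = (List.range m).flatMap g := by
  induction L, h using Nat.le_induction with
  | base => rfl
  | succ L hL ih => rw [List.range_succ, List.flatMap_append, ih]; simp [hg L hL]

theorem flatMap_range {β : Type*} (m : ℕ) (g : ℕ → List β) :
    (List.range m).flatMap g = (List.finRange m).flatMap fun v : Fin m => g v := by
  have h : List.range m = (List.finRange m).map Fin.val := List.ext_getElem (by simp) (by simp)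
  rw [h, List.flatMap_map]

theorem output_graphCmd {n : ℕ} {H : Hypergraph (Fin n)} {w : List (Option Bool)}
    (hH : H.IsInstance) (hE : Encodes w H) :
    graphCmd.output w (fun _ => 0) = graphWord H.dual.coOccurrenceGraph := by
  have hr : Reads id w w := ⟨fun _ => rfl, le_rfl⟩
  have hP := hE.presents hH
  have hn := hP.first.lt_length
  have hfirst : ∀ i, IsFirstSep w i ↔ i = n := fun i =>
    ⟨fun h => h.unique hP.first, fun h => h ▸ hP.first⟩
  rw [graphCmd, Cmd.output, flatMap_range_of_le (m := n + 1) (by omega), List.range_succ,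
    List.flatMap_append, List.flatMap_eq_nil_iff.mpr, List.nil_append, List.flatMap_singleton]
  · rw [Cmd.output, if_pos (by rw [hr.sat_firstSepF]; simp [hfirst]), Cmd.output,
      flatMap_range_of_le (m := n) (by omega), flatMap_range, graphWord, setsWord, List.flatMap_map]
    · congr 1
      funext u
      -- The column loop keeps the value `n` as well, because that round writes the separator ending
      -- the row.
      rw [Cmd.output, if_pos (by simp), Cmd.output, flatMap_range_of_le (m := n + 1) (by omega),
        List.range_succ, List.flatMap_append, flatMap_range, List.flatMap_singleton]
      · congr 1
        · rw [bits, List.ofFn_eq_map, List.map_map, List.map_eq_flatMap]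
          congr 1
          funext v
          rw [Cmd.output, if_pos (by simp), Cmd.output]
          have hadj := hr.sat_adjF (u := u) (v := v) hP hH.vertexSet_eq (env := Function.update
            (Function.update (Function.update (fun _ => 0) 0 n) 1 u) 2 v) (by simp) (by simp)
            (by simp)
          by_cases h : H.dual.coOccurrenceGraph.Adj u v
          · rw [if_pos (hadj.mpr h)]
            simp [Cmd.output, h]
          · rw [if_neg (mt hadj.mp h)]
            simp [Cmd.output, h]
        · simp [Cmd.output]
      · intro i hi
        simp [Cmd.output, show ¬ i < n by omega, show i ≠ n by omega]
    · intro i hi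
      simp [Cmd.output, show ¬ i < n by omega]
  · intro i hi
    have : i < n := by simpa using hi
    rw [Cmd.output, if_neg (by rw [hr.sat_firstSepF]; simp [hfirst]; omega), Cmd.output]
  · intro i hi
    rw [Cmd.output, if_neg (by rw [hr.sat_firstSepF]; simp [hfirst]; omega), Cmd.output]

end DualConformality

theorem mainTheorem3 :
    -- the problem belongs to co-NP
    Complexity.CoNP DualConformality.problem ∧
    -- a certificate exists precisely when the answer is negative
    (∀ (n : ℕ) (H : Hypergraph (Fin n)), H.IsInstance →
      (¬ H.dual.IsConformal ↔ ∃ C : Set (Fin n), DualConformality.IsCertificate H C)) ∧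
    -- certificates can be checked in polynomial time
    Complexity.PolyTimeDecidable Complexity.pairWord
      (fun wc : List (Option Bool) × List Bool =>
        DualConformality.CertificateRel wc.1 wc.2) ∧
    -- the co-occurrence graph of the dual can be computed in polynomial time
    (∃ f : List (Option Bool) → List (Option Bool), Complexity.PolyTimeComputable f ∧
      ∀ (n : ℕ) (H : Hypergraph (Fin n)) (w : List (Option Bool)),
        H.IsInstance → DualConformality.Encodes w H →
          f w = DualConformality.graphWord H.dual.coOccurrenceGraph) :=
  ⟨DualConformality.coNP_problem,
    fun _ _ hH => DualConformality.not_isConformal_dual_iff hH.vertexSet_eq,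
    DualConformality.polyTimeDecidable_certificateRel,
    fun w => DualConformality.graphCmd.output w fun _ => 0,
    DualConformality.graphCmd.nonempty_tm2ComputableInPolyTime DualConformality.wf_graphCmd
      fun _ => rfl,
    fun _ _ _ hH hE => DualConformality.output_graphCmd hH hE⟩
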